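/- Let $R$ be a commutative $\mathbb C$-algebra, let $r\ge 2$ be an integer, and let $\kappa,Q,c_0,c_1,\dots,c_{r-1}\in R$ with $c_{r-1}$ invertible (for instance complex numbers with $c_{r-1}\neq0$, or independent variables with $R=\mathbb C[\kappa,Q,c_0,\dots,c_{r-1},c_{r-1}^{-1}]$). Put $c_a=0$ for $a<1$ or $a>r-1$ in all quadratic expressions below. Let $\mathrm{Vir}$ be the Virasoro algebra over $R$, with generators $L_n$ $(n\in\mathbb Z)$, central element $c$ and $$[L_m,L_n]=(m-n)L_{m+n}+\tfrac{c}{12}(m^3-m)\delta_{m+n,0}.$$ *The irregular Verma module of rank $r-1$.* For $n\ge r-1$ put $$\Lambda'_n=\delta_{n,r-1}\bigl((n+1)Q-c_0\bigr)c_{r-1}-\sum_{\substack{p+q=n\\1\le p,q\le r-1}}c_pc_q ,$$ so that $\Lambda'_n=0$ for $n>2r-2$. Let $M$ be the $\mathrm{Vir}$-module induced from the one-dimensional representation $L_n\mapsto\Lambda'_n$ $(n\ge r-1)$, $c\mapsto\kappa$, of the subalgebra spanned by $c$ and the $L_n$ with $n\ge r-1$, and let $|I^{(r-1)}\rangle\in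 M$ be its cyclic vector; thus $L_n|I^{(r-1)}\rangle=\Lambda'_n|I^{(r-1)}\rangle$ for $n\ge r-1$. *The truncated vector fields.* Let $\Lambda=\Lambda_{2r-1}$ be a further variable. On the space with coordinates $(c_1,\dots,c_{r-1},\Lambda_{2r-1})$ put $$S_m=-\sum_{a=1}^{r-1}c_ac_{m-a}\ (r\le m\le 2r-2),\qquad S_{2r-1}=\Lambda_{2r-1},\qquad S_m=0\ (m>2r-1),$$ and write $\Lambda_n=S_n$ for $r\le n\le 2r-1$. Let $$\mathcal V_0=\sum_{k=1}^{r-1}kc_k\frac{\partial}{\partial c_k}+(2r-1)\Lambda_{2r-1}\frac{\partial}{\partial\Lambda_{2r-1}},$$ and for $1\le n\le r-1$ let $\mathcal V_n=\sum_{k=1}^{r-n}h_{n,k}\frac{\partial}{\partial c_k}$ be the unique rational vector field of this form with $\mathcal V_n(S_m)=(m-n)S_{m+n}$ for $r\le m\le 2r-1$. Let $\mathcal M$ be the $r\times r$ matrix with $(\mathcal V_0,\dots,\mathcal V_{r-1})^{\mathsf T}=\mathcal M\,(\partial_{c_1},\dots,\partial_{c_{r-1}},\partial_{\Lambda_{2r-1}})^{\mathsf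 T}$. With $c_1,\dots,c_{r-1}$ specialized to the given elements of $R$, it is an invertible matrix over $R[\Lambda_{2r-1},\Lambda_{2r-1}^{-1}]$, and one sets $$L_*=\Lambda_{2r-1}^{\,r}\sum_{m=0}^{r-1}(\mathcal M^{-1})_{r,m+1}L_m .$$ **Theorem.** There exists a unique formal series $$W=\Lambda_{2r-1}^{\nu}\exp\Bigl(\sum_{j=1}^{r-1}\frac{g_j}{\Lambda_{2r-1}^{j}}\Bigr)\sum_{k=0}^{\infty}\Lambda_{2r-1}^{k}v_k ,\qquad \nu,g_1,\dots,g_{r-1}\in R,\quad v_k\in M,\quad v_0=|I^{(r-1)}\rangle ,$$ that is, a unique choice of $\nu$, $(g_j)_{1\le j\le r-1}$ and $(v_k)_{k\ge0}$, such that $$L_*W=\Lambda_{2r-1}^{\,r}\frac{\partial}{\partial\Lambda_{2r-1}}W,\qquad L_nW=\Lambda_nW\quad(n=r,r+1,\dots,2r-1).$$ Here the $L_n$ act on the coefficients $v_k$, and $\partial/\partial\Lambda_{2r-1}$ acts on the series and on the prefactor by the usual formal rules. -/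

import Mathlib

noncomputable section

namespace IrregularVector

open scoped LaurentPolynomial
open Finset

/-! ### The Virasoro algebra over a commutative `ℂ`-algebra `R` -/

/-- The underlying module of the Virasoro algebra: finite combinations of the modes `L_n`
(first component), together with multiples of the central element (second component). -/
def Virasoro (R : Type*) [CommRing R] : Type _ := (ℤ →₀ R) × R

namespace Virasoro

variable (R : Type*) [CommRing R]

instance : AddCommGroup (Virasoro R) := inferInstanceAs (AddCommGroup ((ℤ →₀ R) × R))

instance : Module R (Virasoro R) := inferInstanceAs (Module R ((ℤ →₀ R) × R))

/-- The generator `L_n`. -/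
def L (n : ℤ) : Virasoro R := (Finsupp.single n 1, 0)

/-- The central generator `c`. -/
def central : Virasoro R := (0, 1)

/-- The Witt bracket `[L_m, L_n] = (m - n) L_{m+n}`, extended bilinearly. -/
def witt : (ℤ →₀ R) →ₗ[R] (ℤ →₀ R) →ₗ[R] (ℤ →₀ R) :=
  Finsupp.linearCombination R fun m : ℤ =>
    Finsupp.linearCombination R fun n : ℤ => Finsupp.single (m + n) ((m - n : ℤ) : R)

/-- The Virasoro cocycle `(L_m, L_n) ↦ (m³ - m) / 12 · δ_{m+n,0}`, extended bilinearly. -/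
def cocycle [Algebra ℂ R] : (ℤ →₀ R) →ₗ[R] (ℤ →₀ R) →ₗ[R] R :=
  Finsupp.linearCombination R fun m : ℤ =>
    Finsupp.linearCombination R fun n : ℤ =>
      if m + n = 0 then algebraMap ℂ R (((m : ℂ) ^ 3 - m) / 12) else 0

variable {R}

theorem witt_single (m n : ℤ) (a b : R) :
    witt R (Finsupp.single m a) (Finsupp.single n b) =
      Finsupp.single (m + n) (a * b * ((m - n : ℤ) : R)) := by
  simp only [witt, Finsupp.linearCombination_single, LinearMap.smul_apply, Finsupp.smul_single,
    smul_eq_mul, mul_assoc]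

theorem cocycle_single [Algebra ℂ R] (m n : ℤ) (a b : R) :
    cocycle R (Finsupp.single m a) (Finsupp.single n b) =
      a * b * (if m + n = 0 then algebraMap ℂ R (((m : ℂ) ^ 3 - m) / 12) else 0) := by
  simp [cocycle, Finsupp.linearCombination_single, mul_assoc]

theorem witt_skew (x y : ℤ →₀ R) : witt R x y = - witt R y x := by
  induction x using Finsupp.induction_linear with
  | zero => simp
  | add f g hf hg => simp [hf, hg]; abel
  | single m a =>
    induction y using Finsupp.induction_linear with
    | zero => simp
    | add f g hf hg => simp [hf, hg]; abel
    | single n b =>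
      rw [witt_single, witt_single, add_comm n m, ← Finsupp.single_neg]
      congr 1
      push_cast
      ring

theorem cocycle_skew [Algebra ℂ R] (x y : ℤ →₀ R) : cocycle R x y = - cocycle R y x := by
  induction x using Finsupp.induction_linear with
  | zero => simp
  | add f g hf hg => simp [hf, hg]; abel
  | single m a =>
    induction y using Finsupp.induction_linear with
    | zero => simp
    | add f g hf hg => simp [hf, hg]; abel
    | single n b =>
      rw [cocycle_single, cocycle_single, add_comm n m]
      split_ifs with h
      · obtain rfl : n = -m := by omega
        have : (((-m : ℤ) : ℂ) ^ 3 - ((-m : ℤ) : ℂ)) / 12 = - (((m : ℂ) ^ 3 - m) / 12) := by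
          push_cast; ring
        rw [this, map_neg]
        ring
      · simp

theorem witt_jacobi (x y z : ℤ →₀ R) :
    witt R x (witt R y z) = witt R (witt R x y) z + witt R y (witt R x z) := by
  induction x using Finsupp.induction_linear with
  | zero => simp
  | add f g hf hg => simp only [map_add, LinearMap.add_apply, hf, hg]; abel
  | single m a =>
    induction y using Finsupp.induction_linear with
    | zero => simp
    | add f g hf hg => simp only [map_add, LinearMap.add_apply, hf, hg]; abel
    | single n b =>
      induction z using Finsupp.induction_linear with
      | zero => simp
      | add f g hf hg => simp only [map_add, hf, hg]; abel
      | single p d =>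
        simp only [witt_single]
        rw [show m + (n + p) = m + n + p by ring, show n + (m + p) = m + n + p by ring,
          ← Finsupp.single_add]
        congr 1
        push_cast
        ring

theorem cocycle_jacobi [Algebra ℂ R] (x y z : ℤ →₀ R) :
    cocycle R x (witt R y z) = cocycle R (witt R x y) z + cocycle R y (witt R x z) := by
  induction x using Finsupp.induction_linear with
  | zero => simp
  | add f g hf hg => simp only [map_add, LinearMap.add_apply, hf, hg]; abel
  | single m a =>
    induction y using Finsupp.induction_linear with
    | zero => simp
    | add f g hf hg => simp only [map_add, LinearMap.add_apply, hf, hg]; abel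
    | single n b =>
      induction z using Finsupp.induction_linear with
      | zero => simp
      | add f g hf hg => simp only [map_add, hf, hg]; abel
      | single p d =>
        simp only [witt_single, cocycle_single]
        rw [show m + (n + p) = m + n + p by ring, show n + (m + p) = m + n + p by ring]
        split_ifs with h
        · obtain rfl : p = -m - n := by omega
          have key : ((n - (-m - n) : ℤ) : ℂ) * (((m : ℂ) ^ 3 - m) / 12) =
              ((m - n : ℤ) : ℂ) * ((((m + n : ℤ) : ℂ) ^ 3 - ((m + n : ℤ) : ℂ)) / 12) +
              ((m - (-m - n) : ℤ) : ℂ) * (((n : ℂ) ^ 3 - n) / 12) := by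
            push_cast; ring
          have key' := congrArg (algebraMap ℂ R) key
          simp only [map_add, map_mul, map_intCast] at key'
          linear_combination (a * b * d) * key'
        · simp

instance [Algebra ℂ R] : Bracket (Virasoro R) (Virasoro R) :=
  ⟨fun x y => (witt R x.1 y.1, cocycle R x.1 y.1)⟩

theorem bracket_def [Algebra ℂ R] (x y : Virasoro R) :
    ⁅x, y⁆ = ((witt R x.1 y.1, cocycle R x.1 y.1) : (ℤ →₀ R) × R) := rfl

theorem add_fst (x y : Virasoro R) : (x + y).1 = x.1 + y.1 := rfl

theorem smul_fst (a : R) (x : Virasoro R) : (a • x).1 = a • x.1 := rfl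

instance [Algebra ℂ R] : LieRing (Virasoro R) where
  add_lie x y z := by
    simp only [bracket_def, add_fst, map_add, LinearMap.add_apply]
    rfl
  lie_add x y z := by
    simp only [bracket_def, add_fst, map_add]
    rfl
  lie_self x := by
    have two (M : Type _) [AddCommGroup M] [Module R M] (u : M) (h : u = -u) : u = 0 := by
      have h2 : (algebraMap ℂ R 2) • u = 0 := by
        rw [map_ofNat, ofNat_smul_eq_nsmul, two_nsmul]
        nth_rewrite 1 [h]
        simp
      have := congrArg (fun w => (algebraMap ℂ R 2⁻¹) • w) h2
      simpa [smul_smul, ← map_mul] using this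
    exact Prod.ext (two _ _ (witt_skew x.1 x.1)) (two _ _ (cocycle_skew x.1 x.1))
  leibniz_lie x y z := Prod.ext (witt_jacobi x.1 y.1 z.1) (cocycle_jacobi x.1 y.1 z.1)

instance [Algebra ℂ R] : LieAlgebra R (Virasoro R) where
  lie_smul a x y := by
    simp only [bracket_def, smul_fst, map_smul]
    rfl

end Virasoro

section

variable {R : Type*} [CommRing R] [Algebra ℂ R]

/-! ### The irregular Verma module of rank `r - 1` -/

variable (R) in
/-- The universal enveloping algebra of the Virasoro algebra. -/
abbrev UVir : Type _ := UniversalEnvelopingAlgebra R (Virasoro R)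

variable (R) in
/-- The mode `L_n` as an element of the enveloping algebra. -/
def mode (n : ℤ) : UVir R := UniversalEnvelopingAlgebra.ι R (Virasoro.L R n)

/-- The eigenvalues
`Λ'_n = δ_{n,r-1} ((n+1) Q - c_0) c_{r-1} - ∑_{p+q=n, 1 ≤ p,q ≤ r-1} c_p c_q` (`n ≥ r - 1`) of the
irregular vector of rank `r - 1`; they vanish for `n > 2r - 2`. -/
def baseEigenvalue (r : ℕ) (Q : R) (c : ℕ → R) (n : ℕ) : R :=
  (if n = r - 1 then (((n : R) + 1) * Q - c 0) * c (r - 1) else 0) -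
    ∑ p ∈ Icc 1 (r - 1), ∑ q ∈ Icc 1 (r - 1), if p + q = n then c p * c q else 0

/-- The left ideal of the enveloping algebra generated by `L_n - Λ'_n` (`n ≥ r - 1`) and by
`c - κ`, where `κ` is the central charge. -/
def irregularIdeal (r : ℕ) (κ Q : R) (c : ℕ → R) : Submodule (UVir R) (UVir R) :=
  Submodule.span (UVir R)
    ({u | ∃ n : ℕ, r - 1 ≤ n ∧
        u = mode R n - algebraMap R (UVir R) (baseEigenvalue r Q c n)} ∪
      {UniversalEnvelopingAlgebra.ι R (Virasoro.central R) - algebraMap R (UVir R) κ})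

/-- The irregular Verma module of rank `r - 1` and central charge `κ`: the Virasoro module induced
from the one-dimensional representation `L_n ↦ Λ'_n` (`n ≥ r - 1`), `c ↦ κ`. -/
abbrev IrregularVerma (r : ℕ) (κ Q : R) (c : ℕ → R) : Type _ :=
  UVir R ⧸ irregularIdeal r κ Q c

/-- The cyclic vector of the irregular Verma module: the irregular vector of rank `r - 1`. -/
def irregularVector (r : ℕ) (κ Q : R) (c : ℕ → R) : IrregularVerma r κ Q c :=
  Submodule.Quotient.mk 1

/-! ### The parameter space `(c_1, …, c_{r-1}, Λ_{2r-1})` and the truncated vector fields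

The coordinate functions are the polynomial variables `X a = c_a` (`1 ≤ a ≤ r - 1`) and
`X r = Λ_{2r-1}`. Vector fields are evaluated at the point with coordinates
`c_1, …, c_{r-1} ∈ R` and `Λ_{2r-1} = T`, the variable of the Laurent polynomial ring `R[T;T⁻¹]`. A
vector field at this point is the family of its coefficients along
`∂/∂c_1, …, ∂/∂c_{r-1}, ∂/∂Λ_{2r-1}`, indexed by `Fin r` (index `k` belongs to `X (k + 1)`). -/

/-- The coordinate function `c_a`, with `c_a = 0` for `a < 1` and for `a > r - 1`. -/
def coordC (r a : ℕ) : MvPolynomial ℕ ℂ :=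
  if 1 ≤ a ∧ a < r then MvPolynomial.X a else 0

/-- The functions `S_m` (`m ≥ r`): `S_m = -∑_{a=1}^{r-1} c_a c_{m-a}` for `r ≤ m ≤ 2r - 2`,
`S_{2r-1} = Λ_{2r-1}`, and `S_m = 0` for `m > 2r - 1`. -/
def S (r m : ℕ) : MvPolynomial ℕ ℂ :=
  if m < 2 * r - 1 then -∑ a ∈ Icc 1 (r - 1), coordC r a * coordC r (m - a)
  else if m = 2 * r - 1 then MvPolynomial.X r
  else 0

/-- Evaluation of a function of `c_1, …, c_{r-1}, Λ_{2r-1}` at the given `c_1, …, c_{r-1}` and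
`Λ_{2r-1} = T`. -/
def evalAt (r : ℕ) (c : ℕ → R) : MvPolynomial ℕ ℂ →ₐ[ℂ] R[T;T⁻¹] :=
  MvPolynomial.aeval fun a =>
    if a = r then (LaurentPolynomial.T 1 : R[T;T⁻¹]) else LaurentPolynomial.C (c a)

/-- The value `∑_k h_k (∂f/∂x_k)` of the vector field with coefficients `h` on the function `f`. -/
def applyField (r : ℕ) (c : ℕ → R) (h : Fin r → R[T;T⁻¹]) (f : MvPolynomial ℕ ℂ) : R[T;T⁻¹] :=
  ∑ k : Fin r, h k * evalAt r c (MvPolynomial.pderiv ((k : ℕ) + 1) f)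

/-- The conditions defining the truncated Virasoro vector field `𝒱_n` (`1 ≤ n ≤ r - 1`): it has the
form `∑_{k=1}^{r-n} h_{n,k} ∂/∂c_k`, and `𝒱_n(S_m) = (m - n) S_{m+n}` for `r ≤ m ≤ 2r - 1`. -/
def IsTruncatedField (r : ℕ) (c : ℕ → R) (n : ℕ) (h : Fin r → R[T;T⁻¹]) : Prop :=
  (∀ k : Fin r, r - n < (k : ℕ) + 1 → h k = 0) ∧
    ∀ m : ℕ, r ≤ m → m ≤ 2 * r - 1 →
      applyField r c h (S r m) = ((m : R[T;T⁻¹]) - (n : R[T;T⁻¹])) * evalAt r c (S r (m + n))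

/-- The Jacobian matrix of `(S_r, …, S_{2r-1})`. -/
def jacobian (r : ℕ) (c : ℕ → R) : Matrix (Fin r) (Fin r) R[T;T⁻¹] :=
  Matrix.of fun j k => evalAt r c (MvPolynomial.pderiv ((k : ℕ) + 1) (S r (r + j)))

theorem pderiv_coordC (r a k : ℕ) :
    MvPolynomial.pderiv k (coordC r a) = if a = k ∧ 1 ≤ k ∧ k < r then 1 else 0 := by
  unfold coordC
  by_cases h : 1 ≤ a ∧ a < r
  · rw [if_pos h]
    by_cases hk : a = k
    · subst hk
      rw [if_pos ⟨rfl, h⟩, MvPolynomial.pderiv_X_self]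
    · rw [if_neg (fun h' => hk h'.1), MvPolynomial.pderiv_X_of_ne hk]
  · rw [if_neg h, map_zero, if_neg]
    rintro ⟨rfl, h'⟩
    exact h h'

theorem jacobian_blockTriangular (r : ℕ) (c : ℕ → R) :
    (jacobian r c).BlockTriangular id := by
  intro j k hkj
  have hkj : (k : ℕ) < j := hkj
  have hj := j.2
  simp only [jacobian, Matrix.of_apply, S]
  split_ifs with h1 h2
  · rw [map_neg, map_sum, Finset.sum_eq_zero, neg_zero, map_zero]
    intro a ha
    rw [Finset.mem_Icc] at ha
    rw [Derivation.leibniz, pderiv_coordC, pderiv_coordC]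
    have e1 : ¬ (r + (j : ℕ) - a = (k : ℕ) + 1 ∧ 1 ≤ (k : ℕ) + 1 ∧ (k : ℕ) + 1 < r) := by omega
    rw [if_neg e1, smul_zero, zero_add]
    by_cases e2 : a = (k : ℕ) + 1 ∧ 1 ≤ (k : ℕ) + 1 ∧ (k : ℕ) + 1 < r
    · have : coordC r (r + (j : ℕ) - a) = 0 := by
        unfold coordC
        rw [if_neg (by omega)]
      rw [this, zero_smul]
    · rw [if_neg e2, smul_zero]
  · rw [MvPolynomial.pderiv_X_of_ne (by omega), map_zero]
  · simp

theorem jacobian_diag (r : ℕ) (c : ℕ → R) (j : Fin r) :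
    jacobian r c j j = if (j : ℕ) = r - 1 then 1 else LaurentPolynomial.C (-2 * c (r - 1)) := by
  have hj := j.2
  simp only [jacobian, Matrix.of_apply, S]
  split_ifs with h1 h2 h3 h3
  · omega
  · have hsum : ∑ a ∈ Icc 1 (r - 1), MvPolynomial.pderiv ((j : ℕ) + 1)
        (coordC r a * coordC r (r + (j : ℕ) - a)) = 2 * MvPolynomial.X (r - 1) := by
      have e : ∀ a ∈ Icc 1 (r - 1), MvPolynomial.pderiv ((j : ℕ) + 1)
          (coordC r a * coordC r (r + (j : ℕ) - a)) =
          (if a = r - 1 then MvPolynomial.X (r - 1) else 0) +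
          (if a = (j : ℕ) + 1 then MvPolynomial.X (r - 1) else 0) := by
        intro a ha
        rw [Finset.mem_Icc] at ha
        rw [Derivation.leibniz, pderiv_coordC, pderiv_coordC, smul_eq_mul, smul_eq_mul]
        congr 1
        · by_cases ha' : a = r - 1
          · rw [if_pos ha', if_pos (by omega), mul_one, coordC, if_pos (by omega), ha']
          · rw [if_neg ha', if_neg (by omega), mul_zero]
        · by_cases ha' : a = (j : ℕ) + 1
          · rw [if_pos ha', if_pos (by omega), mul_one, coordC, if_pos (by omega)]
            congr 1
            omega
          · rw [if_neg ha', if_neg (by omega), mul_zero]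
      rw [Finset.sum_congr rfl e, Finset.sum_add_distrib, Finset.sum_ite_eq', Finset.sum_ite_eq',
        if_pos (by rw [Finset.mem_Icc]; omega), if_pos (by rw [Finset.mem_Icc]; omega), two_mul]
    rw [map_neg, map_sum, hsum, map_neg, map_mul, map_ofNat, evalAt, MvPolynomial.aeval_X,
      if_neg (by omega), map_mul, map_neg, map_ofNat, neg_mul]
  · rw [show (j : ℕ) + 1 = r by omega, MvPolynomial.pderiv_X_self, map_one]
  · omega
  · omega
  · omega

theorem isUnit_jacobian_det (r : ℕ) (c : ℕ → R) (hc : IsUnit (c (r - 1))) :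
    IsUnit (jacobian r c).det := by
  rw [Matrix.det_of_isUpperTriangular (jacobian_blockTriangular r c)]
  have h2 : IsUnit (-2 : R) := by
    have : IsUnit (algebraMap ℂ R (-2)) := (IsUnit.mk0 (-2 : ℂ) (by norm_num)).map _
    rwa [map_neg, map_ofNat] at this
  refine IsUnit.prod_univ_iff.2 fun j => ?_
  rw [jacobian_diag]
  split_ifs
  · exact isUnit_one
  · exact (h2.mul hc).map _

theorem existsUnique_truncatedField (r : ℕ) (c : ℕ → R) (hc : IsUnit (c (r - 1)))
    (n : ℕ) (hn : n < r) : ∃! h : Fin r → R[T;T⁻¹], IsTruncatedField r c n h := by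
  have hdet := isUnit_jacobian_det r c hc
  set J := jacobian r c with hJ
  have key : ∀ (h : Fin r → R[T;T⁻¹]) (j : Fin r),
      applyField r c h (S r (r + j)) = J.mulVec h j := by
    intro h j
    simp only [applyField, Matrix.mulVec, dotProduct, hJ, jacobian, Matrix.of_apply]
    exact Finset.sum_congr rfl fun k _ => mul_comm _ _
  set y : Fin r → R[T;T⁻¹] := fun j =>
    (((r + (j : ℕ) : ℕ) : R[T;T⁻¹]) - (n : R[T;T⁻¹])) * evalAt r c (S r (r + j + n)) with hy
  have iff2 : ∀ h : Fin r → R[T;T⁻¹],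
      (∀ m : ℕ, r ≤ m → m ≤ 2 * r - 1 → applyField r c h (S r m) =
        ((m : R[T;T⁻¹]) - (n : R[T;T⁻¹])) * evalAt r c (S r (m + n))) ↔ J.mulVec h = y := by
    intro h
    constructor
    · intro H
      funext j
      rw [← key]
      exact H _ (by omega) (by have := j.2; omega)
    · intro H m h1 h2
      have := congrFun H ⟨m - r, by omega⟩
      rw [← key, hy] at this
      simpa only [Nat.add_sub_cancel' h1] using this
  have inv : ∀ h : Fin r → R[T;T⁻¹], J.mulVec h = y ↔ h = J⁻¹.mulVec y := by
    intro h
    constructor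
    · intro H
      rw [← H, Matrix.mulVec_mulVec, Matrix.nonsing_inv_mul _ hdet, Matrix.one_mulVec]
    · intro H
      rw [H, Matrix.mulVec_mulVec, Matrix.mul_nonsing_inv _ hdet, Matrix.one_mulVec]
  refine ⟨J⁻¹.mulVec y, ⟨?_, (iff2 _).2 ((inv _).2 rfl)⟩, fun h hh => (inv h).1 ((iff2 h).1 hh.2)⟩
  intro k hk
  have : Invertible J := J.invertibleOfIsUnitDet hdet
  have htri : (J⁻¹).BlockTriangular id :=
    Matrix.blockTriangular_inv_of_blockTriangular (jacobian_blockTriangular r c)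
  simp only [Matrix.mulVec, dotProduct]
  refine Finset.sum_eq_zero fun j _ => ?_
  by_cases hjk : j < k
  · rw [htri hjk, zero_mul]
  · have hjk' : (k : ℕ) ≤ j := Fin.le_def.1 (not_lt.1 hjk)
    have hS : S r (r + j + n) = 0 := by
      unfold S
      rw [if_neg (by omega), if_neg (by omega)]
    rw [hy]
    simp only [hS, map_zero, mul_zero]

/-- The coefficients of the truncated Virasoro vector field `𝒱_n`, `1 ≤ n ≤ r - 1`. -/
def truncatedField (r : ℕ) (c : ℕ → R) (hc : IsUnit (c (r - 1))) (n : ℕ) (hn : n < r) :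
    Fin r → R[T;T⁻¹] :=
  (existsUnique_truncatedField r c hc n hn).choose

/-- The coefficients of the Euler field
`𝒱_0 = ∑_{k=1}^{r-1} k c_k ∂/∂c_k + (2r - 1) Λ_{2r-1} ∂/∂Λ_{2r-1}`. -/
def eulerField (r : ℕ) (c : ℕ → R) : Fin r → R[T;T⁻¹] := fun k =>
  if (k : ℕ) + 1 = r then LaurentPolynomial.C (2 * (r : R) - 1) * LaurentPolynomial.T 1
  else LaurentPolynomial.C (((k : R) + 1) * c ((k : ℕ) + 1))

/-- The matrix `ℳ` whose row `n` (`0 ≤ n ≤ r - 1`) lists the coefficients of `𝒱_n` along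
`∂/∂c_1, …, ∂/∂c_{r-1}, ∂/∂Λ_{2r-1}`. -/
def fieldMatrix (r : ℕ) (c : ℕ → R) (hc : IsUnit (c (r - 1))) :
    Matrix (Fin r) (Fin r) R[T;T⁻¹] :=
  Matrix.of fun n => if (n : ℕ) = 0 then eulerField r c else truncatedField r c hc n n.2

theorem truncatedField_spec (r : ℕ) (c : ℕ → R) (hc : IsUnit (c (r - 1))) (n : ℕ) (hn : n < r) :
    IsTruncatedField r c n (truncatedField r c hc n hn) :=
  (existsUnique_truncatedField r c hc n hn).choose_spec.1

theorem isUnit_of_complex {z : ℂ} (hz : z ≠ 0) : IsUnit (algebraMap ℂ R z) :=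
  (IsUnit.mk0 z hz).map _

/-- The matrix `ℳ` is invertible, so that `ℳ⁻¹` below is a genuine inverse. -/
theorem isUnit_fieldMatrix_det (r : ℕ) (c : ℕ → R) (hc : IsUnit (c (r - 1))) :
    IsUnit (fieldMatrix r c hc).det := by
  have htri : ((fieldMatrix r c hc).submatrix id Fin.revPerm).BlockTriangular id := by
    intro i j hji
    have hji : (j : ℕ) < i := hji
    have hi := i.2
    simp only [fieldMatrix, Matrix.submatrix_apply, Matrix.of_apply, id_eq, Fin.revPerm_apply]
    rw [if_neg (by omega)]
    refine (truncatedField_spec r c hc i i.2).1 _ ?_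
    rw [Fin.val_rev]
    omega
  have hdiag : ∀ i : Fin r, IsUnit ((fieldMatrix r c hc).submatrix id Fin.revPerm i i) := by
    intro i
    have hi := i.2
    simp only [fieldMatrix, Matrix.submatrix_apply, Matrix.of_apply, id_eq, Fin.revPerm_apply]
    by_cases h0 : (i : ℕ) = 0
    · rw [if_pos h0, eulerField, if_pos (by rw [Fin.val_rev]; omega)]
      refine IsUnit.mul (IsUnit.map _ ?_) (LaurentPolynomial.isUnit_T 1)
      have hz : (2 * (r : ℂ) - 1) ≠ 0 := by
        have : ((2 * (r : ℤ) - 1 : ℤ) : ℂ) ≠ 0 := by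
          rw [Int.cast_ne_zero]; omega
        push_cast at this
        exact this
      have hu := isUnit_of_complex (R := R) hz
      rwa [map_sub, map_mul, map_ofNat, map_natCast, map_one] at hu
    · rw [if_neg h0]
      set h := truncatedField r c hc i i.2 with hh
      obtain ⟨h1, h2⟩ := truncatedField_spec r c hc i i.2
      rw [← hh] at h1 h2
      have e := h2 (r + (Fin.rev i : Fin r)) (by omega) (by rw [Fin.val_rev]; omega)
      have hsum : applyField r c h (S r (r + (Fin.rev i : Fin r))) =
          h (Fin.rev i) * jacobian r c (Fin.rev i) (Fin.rev i) := by
        unfold applyField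
        rw [Finset.sum_eq_single (Fin.rev i)]
        · rfl
        · intro k _ hk
          rcases lt_or_gt_of_ne hk with hlt | hgt
          · have : jacobian r c (Fin.rev i) k = 0 := jacobian_blockTriangular r c hlt
            rw [jacobian, Matrix.of_apply] at this
            rw [this, mul_zero]
          · rw [h1 k, zero_mul]
            have : ((Fin.rev i : Fin r) : ℕ) < k := hgt
            rw [Fin.val_rev] at this
            omega
        · intro hk
          exact absurd (Finset.mem_univ _) hk
      have hS : evalAt r c (S r (r + (Fin.rev i : Fin r) + i)) = LaurentPolynomial.T 1 := by
        unfold S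
        rw [if_neg (by rw [Fin.val_rev]; omega), if_pos (by rw [Fin.val_rev]; omega), evalAt,
          MvPolynomial.aeval_X, if_pos rfl]
      rw [hsum, hS] at e
      have hz : (((r + (Fin.rev i : Fin r) : ℕ) : ℂ) - ((i : ℕ) : ℂ)) ≠ 0 := by
        have : (((r + (Fin.rev i : Fin r) : ℕ) : ℤ) - ((i : ℕ) : ℤ) : ℤ) ≠ 0 := by
          rw [Fin.val_rev]; omega
        have := (Int.cast_ne_zero (α := ℂ)).2 this
        push_cast at this ⊢
        exact this
      have hu : IsUnit (((r + (Fin.rev i : Fin r) : ℕ) : R[T;T⁻¹]) - ((i : ℕ) : R[T;T⁻¹])) := by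
        have := isUnit_of_complex (R := R[T;T⁻¹]) hz
        rwa [map_sub, map_natCast, map_natCast] at this
      exact isUnit_of_mul_isUnit_left (e ▸ hu.mul (LaurentPolynomial.isUnit_T 1))
  have hdet : IsUnit ((fieldMatrix r c hc).submatrix id Fin.revPerm).det := by
    rw [Matrix.det_of_isUpperTriangular htri]
    exact IsUnit.prod_univ_iff.2 hdiag
  rw [Matrix.det_permute'] at hdet
  exact isUnit_of_mul_isUnit_right hdet

end

/-! ### Formal series with an irregular prefactor -/

/-- A formal expression `Λ^ν exp(∑_{j=1}^{d} g_j / Λ^j) ∑_{k ∈ ℤ} Λ^k v_k` in a formal variable `Λ`,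
with `ν, g_1, …, g_d` in `R` and `v_k` in the `R`-module `M`. The entry `polar j` is `g_{j+1}`. -/
@[ext]
structure FormalSeries (d : ℕ) (R M : Type*) where
  /-- the exponent `ν` -/
  exponent : R
  /-- the coefficients `g_1, …, g_d` of the exponential factor -/
  polar : Fin d → R
  /-- the coefficients `v_k` -/
  coeff : ℤ → M

namespace FormalSeries

variable {d : ℕ} {R M : Type*} [CommRing R] [AddCommGroup M] [Module R M]

/-- The formal derivative `∂/∂Λ`: the prefactor `Λ^ν exp(∑_j g_j / Λ^j)` has logarithmic derivative
`ν / Λ - ∑_j j g_j / Λ^{j+1}`. -/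
def deriv (W : FormalSeries d R M) : FormalSeries d R M where
  exponent := W.exponent
  polar := W.polar
  coeff k := ((k : R) + 1) • W.coeff (k + 1) + W.exponent • W.coeff (k + 1) -
    ∑ j : Fin d, (((j : ℕ) : R) + 1) • W.polar j • W.coeff (k + ((j : ℕ) + 1) + 1)

/-- Apply an operator on `M` to all the coefficients. -/
def mapCoeff (φ : M → M) (W : FormalSeries d R M) : FormalSeries d R M where
  exponent := W.exponent
  polar := W.polar
  coeff k := φ (W.coeff k)

/-- Multiplication by a Laurent polynomial `p = ∑_i p_i Λ^i`. -/
def mulLaurent (p : LaurentPolynomial R) (W : FormalSeries d R M) : FormalSeries d R M where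
  exponent := W.exponent
  polar := W.polar
  coeff k := ∑ i ∈ p.coeff.support, p.coeff i • W.coeff (k - i)

end FormalSeries

section

variable {R : Type*} [CommRing R] [Algebra ℂ R]

/-- The action of `L_n` on formal series with values in the irregular Verma module. -/
def modeAct {r d : ℕ} {κ Q : R} {c : ℕ → R} (n : ℤ)
    (W : FormalSeries d R (IrregularVerma r κ Q c)) :
    FormalSeries d R (IrregularVerma r κ Q c) :=
  W.mapCoeff fun v => mode R n • v

/-- The canonical operator `L_* = Λ_{2r-1}^r ∑_{m=0}^{r-1} (ℳ⁻¹)_{r,m+1} L_m`. -/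
def lStar {r d : ℕ} {κ Q : R} {c : ℕ → R} (hr : 2 ≤ r) (hc : IsUnit (c (r - 1)))
    (W : FormalSeries d R (IrregularVerma r κ Q c)) :
    FormalSeries d R (IrregularVerma r κ Q c) where
  exponent := W.exponent
  polar := W.polar
  coeff k := ∑ m : Fin r,
    ((modeAct (m : ℕ) W).mulLaurent
      (LaurentPolynomial.T r * (fieldMatrix r c hc)⁻¹ ⟨r - 1, by omega⟩ m)).coeff k

end

end IrregularVector

end

/-!
# Irregular vectors of half-integer rank in irregular Verma modules

Put `I = |I^(r-1)⟩` and `Z_i = L_{r-1+i} - Λ'_{r-1+i}`, where `Λ'_n` is read as `0` for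
`n < r - 1`. The `Z_i` with `i ≥ 0` kill `I`, and for the filtration of the irregular Verma module
by the degree of words `Z_{-j₁} ⋯ Z_{-jₖ} I` the commutators `[Z_i, Z_j]` are
`-2 i c_{r-1}² δ_{i+j,0}` up to terms of lower degree (`isAlmostHeisenberg`). So the associated
graded module looks like a Fock space on which `Z_i`, `i ≥ 1`, acts as a derivative, and
`∑_{j ≥ 1} Z_{-j} Z_j` as a multiple of the Euler operator. This gives two facts by induction on
the degree: the common kernel of the `Z_i`, `i ≥ 1`, consists of the multiples of `I`
(`IsAlmostHeisenberg.mem_span_of_forall_eq_zero`), and the system `Z_i v = w_i`, `i ≥ 1`, can be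
solved whenever it is compatible with the commutation relations
(`IsAlmostHeisenberg.exists_apply_eq`). In addition `I` is torsion-free over `R`: it is mapped to
the vacuum of a free field representation of the Virasoro algebra, by two bosons in light-cone
coordinates with a background charge (`eq_zero_of_smul_irregularVector`). This replaces the
Poincaré–Birkhoff–Witt theorem.

Write `Λ` for `Λ_{2r-1}`. By the two facts, the power series `∑_k Λ^k v_k` that satisfy
`L_n v = Λ_n v` for all `n ≥ r` are exactly the multiples `f v`, `f ∈ R⟦Λ⟧`, of one solution `v`
with `v_0 = I` (`exists_mem_eigenSeries`, `exists_eq_smul_of_mem_eigenSeries`). The coefficients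
`A_m` of `L_*` are polynomials in `Λ`, and since `∑_m A_m 𝒱_m = Λ^r ∂/∂Λ`, the operator
`D = L_* - Λ^r ∂/∂Λ` preserves this space (`canonicalOp_mem_eigenSeries`). Therefore `D v = φ v`
for some `φ ∈ R⟦Λ⟧`. A prefactor with parameters `ν` and `g_j` turns the canonical equation into
`D w = P w`, where `P = ν Λ^{r-1} - ∑_j j g_j Λ^{r-1-j}`. Since `D (f v) = f D v - Λ^r f' v`, the
class of `φ` modulo `Λ^r` determines `P`, hence `ν` and the `g_j`; and if `φ = P + Λ^r ψ`, then
`w = f v` is a solution exactly when `f' = ψ f`, which has one solution with `f(0) = 1`.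

For uniqueness, the equations `L_n w = Λ_n w` are given for `n ≤ 2r - 1` only. Iterated
commutators of the `L_n` with `r ≤ n ≤ 2r - 1` give them for `n > 2r`, and the commutator of
`L_{2r-1}` with `D` gives `A_1 L_{2r} w = 0`, where `A_1` is a unit times `Λ^{r-2}`
(`mem_eigenSeries_of_canonical`).
-/

noncomputable section

namespace IrregularVector

open scoped LaurentPolynomial PowerSeries
open Finset.HasAntidiagonal (antidiagonal mem_antidiagonal)

/-! ### Filtered modules with almost canonical commutation relations -/

section AlmostHeisenberg

variable {R M : Type*} [CommRing R] [AddCommGroup M] [Module R M]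

/-- `IsWord Z I d w` says that `w = Z_{-j₁} ⋯ Z_{-jₖ} I` with `jᵢ ≥ 1` and `∑ jᵢ ≤ d`. -/
inductive IsWord (Z : ℤ → Module.End R M) (I : M) : ℤ → M → Prop
  | vac {d : ℤ} (hd : 0 ≤ d) : IsWord Z I d I
  | step {d : ℤ} {w : M} (j : ℤ) (hj : 1 ≤ j) (h : IsWord Z I d w) :
      IsWord Z I (d + j) (Z (-j) w)

/-- The increasing filtration by total degree: the span of the words of degree at most `d`. -/
def wordFiltration (Z : ℤ → Module.End R M) (I : M) (d : ℤ) : Submodule R M :=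
  Submodule.span R {w | IsWord Z I d w}

/-- Operators `Z_i`, `i ∈ ℤ`, with a vector `I` killed by all `Z_i`, `i ≥ 0`, and with
`[Z_i, Z_j] = (i - j) Z_{i+j+s} + ξ_{i,j}`, where `s ≥ 1`. The scalars `ξ_{i,j}` vanish for
`i + j > 0` and `ξ_{i,-i} = i l`. With respect to the word filtration `Z_i` has degree `-i`, and up
to terms of lower degree the `Z_i` satisfy the canonical commutation relations of a Heisenberg
algebra of level `l`. -/
structure IsAlmostHeisenberg (Z : ℤ → Module.End R M) (I : M) (s : ℤ) (ξ : ℤ → ℤ → R) (l : R) :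
    Prop where
  one_le : 1 ≤ s
  vac : ∀ i : ℤ, 0 ≤ i → Z i I = 0
  comm : ∀ (i j : ℤ) (w : M),
    Z i (Z j w) = Z j (Z i w) + (((i - j : ℤ) : R) • Z (i + j + s) w + ξ i j • w)
  ξ_of_pos : ∀ i j : ℤ, 0 < i + j → ξ i j = 0
  ξ_neg : ∀ i : ℤ, ξ i (-i) = (i : R) * l

variable {Z : ℤ → Module.End R M} {I : M}

theorem IsWord.nonneg {d : ℤ} {w : M} (h : IsWord Z I d w) : 0 ≤ d := by
  induction h with
  | vac hd => exact hd
  | step j hj _ ih => omega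

theorem IsWord.mono {d e : ℤ} {w : M} (h : IsWord Z I d w) (hde : d ≤ e) : IsWord Z I e w := by
  induction h generalizing e with
  | vac hd => exact .vac (hd.trans hde)
  | step j hj _ ih =>
    have := (ih (e := e - j) (by omega)).step j hj
    rwa [sub_add_cancel] at this

theorem wordFiltration_mono {d e : ℤ} (hde : d ≤ e) :
    wordFiltration Z I d ≤ wordFiltration Z I e :=
  Submodule.span_mono fun _ h => IsWord.mono h hde

theorem wordFiltration_of_neg {d : ℤ} (hd : d < 0) : wordFiltration Z I d = ⊥ := by
  rw [wordFiltration, Submodule.span_eq_bot]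
  intro w hw
  exact absurd (IsWord.nonneg hw) (by omega)

theorem vac_mem_wordFiltration {d : ℤ} (hd : 0 ≤ d) : I ∈ wordFiltration Z I d :=
  Submodule.subset_span (.vac hd)

theorem wordFiltration_zero : wordFiltration Z I 0 = Submodule.span R {I} := by
  refine le_antisymm (Submodule.span_le.2 ?_) ?_
  · have key : ∀ d w, IsWord Z I d w → d ≤ 0 → w ∈ Submodule.span R {I} := by
      intro d w h hd
      cases h with
      | vac _ => exact Submodule.mem_span_singleton_self I
      | step j hj h => have := h.nonneg; omega
    exact fun w hw => key 0 w hw le_rfl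
  · rw [Submodule.span_singleton_le_iff_mem]
    exact vac_mem_wordFiltration le_rfl

theorem raise_mem_wordFiltration {d j : ℤ} (hj : 1 ≤ j) {w : M} (hw : w ∈ wordFiltration Z I d) :
    Z (-j) w ∈ wordFiltration Z I (d + j) := by
  induction hw using Submodule.span_induction with
  | mem w h => exact Submodule.subset_span (IsWord.step j hj h)
  | zero => simp
  | add x y _ _ hx hy => rw [map_add]; exact add_mem hx hy
  | smul a x _ hx => rw [map_smul]; exact Submodule.smul_mem _ _ hx

namespace IsAlmostHeisenberg

variable {s l} {ξ : ℤ → ℤ → R} (H : IsAlmostHeisenberg Z I s ξ l)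

include H

theorem apply_mem {d i : ℤ} {w : M} (hw : w ∈ wordFiltration Z I d) :
    Z i w ∈ wordFiltration Z I (d - i) := by
  have hneg : ∀ {d i : ℤ} {w : M}, i < 0 → w ∈ wordFiltration Z I d →
      Z i w ∈ wordFiltration Z I (d - i) := by
    intro d i w hi hw
    have := raise_mem_wordFiltration (j := -i) (by omega) hw
    rwa [neg_neg, ← sub_eq_add_neg] at this
  have key : ∀ {d : ℤ} {w : M}, IsWord Z I d w → ∀ i, Z i w ∈ wordFiltration Z I (d - i) := by
    intro d w h
    induction h with
    | @vac d hd =>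
      intro i
      rcases lt_or_ge i 0 with hi | hi
      · exact hneg hi (vac_mem_wordFiltration hd)
      · rw [H.vac i hi]; exact zero_mem _
    | @step d w j hj h ih =>
      intro i
      rw [H.comm]
      refine add_mem ?_ (add_mem (Submodule.smul_mem _ _ ?_) ?_)
      · refine wordFiltration_mono (by omega) (raise_mem_wordFiltration hj (ih i))
      · exact wordFiltration_mono (by have := H.one_le; omega) (ih (i + -j + s))
      · by_cases hij : 0 < i + -j
        · rw [H.ξ_of_pos _ _ hij, zero_smul]; exact zero_mem _
        · exact Submodule.smul_mem _ _
            (wordFiltration_mono (by omega) (Submodule.subset_span h))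
  induction hw using Submodule.span_induction with
  | mem w h => exact key h i
  | zero => simp
  | add x y _ _ hx hy => rw [map_add]; exact add_mem hx hy
  | smul a x _ hx => rw [map_smul]; exact Submodule.smul_mem _ _ hx

/-- The canonical commutation relations on the associated graded module. -/
theorem comm_mem {e : ℤ} (i j : ℤ) {w : M} (hw : w ∈ wordFiltration Z I e) :
    Z i (Z j w) - Z j (Z i w) - (if i + j = 0 then ((i : R) * l) • w else 0) ∈
      wordFiltration Z I (e - i - j - 1) := by
  have hs := H.one_le
  have h1 : ((i - j : ℤ) : R) • Z (i + j + s) w ∈ wordFiltration Z I (e - i - j - 1) :=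
    Submodule.smul_mem _ _ (wordFiltration_mono (by omega) (H.apply_mem hw))
  rw [H.comm, add_sub_cancel_left, add_sub_assoc]
  refine add_mem h1 ?_
  rcases lt_trichotomy (i + j) 0 with h | h | h
  · rw [if_neg h.ne, sub_zero]
    exact Submodule.smul_mem _ _ (wordFiltration_mono (by omega) hw)
  · obtain rfl : j = -i := by omega
    rw [if_pos h, H.ξ_neg, sub_self]
    exact zero_mem _
  · rw [if_neg h.ne', H.ξ_of_pos _ _ h, zero_smul, sub_zero]
    exact zero_mem _

/-- `∑ⱼ Z_{-j} Z_j` acts on the degree `d` part of the associated graded module as `d l`. -/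
theorem euler_mem {d N : ℤ} (hN : d ≤ N) {w : M} (hw : w ∈ wordFiltration Z I d) :
    ∑ j ∈ Finset.Icc 1 N, Z (-j) (Z j w) - ((d : R) * l) • w ∈ wordFiltration Z I (d - 1) := by
  have key : ∀ {d : ℤ} {w : M}, IsWord Z I d w → d ≤ N →
      ∑ j ∈ Finset.Icc 1 N, Z (-j) (Z j w) - ((d : R) * l) • w ∈ wordFiltration Z I (d - 1) := by
    intro d w h
    induction h with
    | @vac d hd =>
      intro _
      rw [Finset.sum_eq_zero fun j hj => by
        rw [H.vac j (by rw [Finset.mem_Icc] at hj; omega), map_zero], zero_sub]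
      rcases hd.eq_or_lt with rfl | h
      · simp
      · exact neg_mem (Submodule.smul_mem _ _ (vac_mem_wordFiltration (by omega)))
    | @step d w k hk h ih =>
      intro hdk
      have hd := h.nonneg
      have hw : w ∈ wordFiltration Z I d := Submodule.subset_span h
      have hterm : ∀ j ∈ Finset.Icc 1 N, Z (-j) (Z j (Z (-k) w)) - (Z (-k) (Z (-j) (Z j w)) +
          if j = k then ((k : R) * l) • Z (-k) w else 0) ∈
            wordFiltration Z I (d + k - 1) := by
        intro j hj
        rw [Finset.mem_Icc] at hj
        have h1 := H.apply_mem (i := -j) (H.comm_mem j (-k) hw)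
        have h2 := H.comm_mem (-j) (-k) (H.apply_mem (i := j) hw)
        have e : -j + -k ≠ 0 := by omega
        rw [if_neg e, sub_zero] at h2
        rw [map_sub, map_sub, apply_ite (Z (-j)), map_smul, map_zero] at h1
        have h3 := add_mem (wordFiltration_mono (by omega) h1 :
          _ ∈ wordFiltration Z I (d + k - 1)) (wordFiltration_mono (by omega) h2)
        convert h3 using 1
        by_cases hjk : j = k
        · subst hjk
          rw [if_pos rfl, if_pos (by omega)]
          abel
        · rw [if_neg hjk, if_neg (by omega)]
          abel
      have h4 := sum_mem hterm
      rw [Finset.sum_sub_distrib, Finset.sum_add_distrib, Finset.sum_ite_eq',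
        if_pos (by rw [Finset.mem_Icc]; omega), ← map_sum] at h4
      have h5 := raise_mem_wordFiltration hk (ih (by omega))
      have h6 := add_mem h4 (wordFiltration_mono (by omega) h5)
      convert h6 using 1
      rw [map_sub, map_smul]
      push_cast
      module
  induction hw using Submodule.span_induction with
  | mem w h => exact key h hN
  | zero => simp
  | add x y _ _ hx hy =>
    convert add_mem hx hy using 1
    simp only [map_add, Finset.sum_add_distrib, smul_add]
    abel
  | smul a x _ hx =>
    convert Submodule.smul_mem _ a hx using 1
    simp only [map_smul, Finset.smul_sum, smul_sub, smul_comm a]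

/-- The common kernel of the `Z_i`, `i ≥ 1`, consists of the multiples of `I`. -/
theorem mem_span_of_forall_eq_zero (hl : ∀ n : ℕ, n ≠ 0 → IsUnit ((n : R) * l))
    (d : ℕ) {w : M} (hw : w ∈ wordFiltration Z I d) (h : ∀ i : ℤ, 1 ≤ i → Z i w = 0) :
    w ∈ Submodule.span R {I} := by
  induction d with
  | zero => rwa [Nat.cast_zero, wordFiltration_zero] at hw
  | succ d ih =>
    refine ih ?_
    have h1 := H.euler_mem le_rfl hw
    rw [Finset.sum_eq_zero fun j hj => by
      rw [h j (by rw [Finset.mem_Icc] at hj; omega), map_zero], zero_sub, neg_mem_iff,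
      Int.cast_natCast] at h1
    obtain ⟨u, hu⟩ := hl (d + 1) (by omega)
    have h2 := Submodule.smul_mem _ (↑u⁻¹ : R) h1
    rw [smul_smul, ← hu, Units.inv_mul, one_smul] at h2
    exact wordFiltration_mono (by push_cast; omega) h2

/-- The system `Z_i v = w_i`, `i ≥ 1`, is solvable as soon as it is compatible with the
commutation relations. This is the Poincaré lemma for the operators `Z_i`: the vector
`(d l)⁻¹ ∑ⱼ Z_{-j} w_j` is a solution up to terms of lower degree. -/
theorem exists_apply_eq (hl : ∀ n : ℕ, n ≠ 0 → IsUnit ((n : R) * l)) (d : ℕ) (w : ℤ → M)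
    (hw : ∀ i : ℤ, 1 ≤ i → w i ∈ wordFiltration Z I (d - i))
    (hcomm : ∀ i j : ℤ, 1 ≤ i → 1 ≤ j →
      Z i (w j) = Z j (w i) + ((i - j : ℤ) : R) • w (i + j + s)) :
    ∃ v ∈ wordFiltration Z I d, ∀ i : ℤ, 1 ≤ i → Z i v = w i := by
  have hs := H.one_le
  induction d generalizing w with
  | zero =>
    refine ⟨0, zero_mem _, fun i hi => ?_⟩
    have := hw i hi
    rw [wordFiltration_of_neg (by omega), Submodule.mem_bot] at this
    rw [this, map_zero]
  | succ d ih =>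
    obtain ⟨u, hu⟩ := hl (d + 1) (by omega)
    set N : ℤ := d + 1 with hN
    set v₀ : M := (↑u⁻¹ : R) • ∑ j ∈ Finset.Icc 1 N, Z (-j) (w j) with hv₀
    have hv₀mem : v₀ ∈ wordFiltration Z I ((d + 1 : ℕ) : ℤ) := by
      refine Submodule.smul_mem _ _ (sum_mem fun j hj => ?_)
      rw [Finset.mem_Icc] at hj
      exact wordFiltration_mono (by omega) (H.apply_mem (hw j hj.1))
    have hclose : ∀ i : ℤ, 1 ≤ i → w i - Z i v₀ ∈ wordFiltration Z I (d - i) := by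
      intro i hi
      have hterm : ∀ j ∈ Finset.Icc 1 N, Z i (Z (-j) (w j)) - (Z (-j) (Z j (w i)) +
          if i = j then ((i : R) * l) • w i else 0) ∈ wordFiltration Z I (d - i) := by
        intro j hj
        rw [Finset.mem_Icc] at hj
        have h1 := H.comm_mem i (-j) (hw j hj.1)
        have h2 : Z (-j) (((i - j : ℤ) : R) • w (i + j + s)) ∈ wordFiltration Z I (d - i) :=
          wordFiltration_mono (by push_cast; omega)
            (H.apply_mem (Submodule.smul_mem _ _ (hw (i + j + s) (by omega))))
        have h3 := add_mem (wordFiltration_mono (by push_cast; omega) h1 :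
          _ ∈ wordFiltration Z I (d - i)) h2
        rw [hcomm i j hi hj.1, map_add] at h3
        convert h3 using 1
        by_cases hij : i = j
        · subst hij
          rw [if_pos rfl, if_pos (by omega)]
          abel
        · rw [if_neg hij, if_neg (by omega)]
          abel
      have h4 := sum_mem hterm
      rw [Finset.sum_sub_distrib, Finset.sum_add_distrib, Finset.sum_ite_eq, ← map_sum] at h4
      have h5 : ∑ j ∈ Finset.Icc 1 N, Z (-j) (Z j (w i)) - ((((d + 1 : ℕ) - i : ℤ) : R) * l) • w i ∈
          wordFiltration Z I (d - i) :=
        wordFiltration_mono (by push_cast; omega)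
          (H.euler_mem (N := N) (by push_cast; omega) (hw i hi))
      have h6 : (if i ∈ Finset.Icc 1 N then ((i : R) * l) • w i else 0) = ((i : R) * l) • w i := by
        split_ifs with h
        · rfl
        · have := hw i hi
          rw [Finset.mem_Icc] at h
          rw [wordFiltration_of_neg (by push_cast; omega), Submodule.mem_bot] at this
          rw [this, smul_zero]
      rw [h6] at h4
      have h7 := Submodule.smul_mem _ (-↑u⁻¹ : R) (add_mem h4 h5)
      convert h7 using 1
      have h8 : w i = (↑u⁻¹ : R) • ((((d + 1 : ℕ) : R) * l) • w i) := by
        rw [← hu, smul_smul, Units.inv_mul, one_smul]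
      rw [hv₀, map_smul]
      nth_rewrite 1 [h8]
      push_cast
      module
    obtain ⟨v₁, hv₁, hv₁'⟩ := ih (fun i => w i - Z i v₀) hclose (by
      intro i j hi hj
      rw [map_sub, map_sub, hcomm i j hi hj, H.comm i j, smul_sub]
      rcases lt_or_ge 0 (i + j) with h | h
      · rw [H.ξ_of_pos _ _ h, zero_smul]
        abel
      · omega)
    refine ⟨v₀ + v₁, add_mem hv₀mem (wordFiltration_mono (by push_cast; omega) hv₁), fun i hi => ?_⟩
    rw [map_add, hv₁' i hi, add_sub_cancel]

end IsAlmostHeisenberg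

end AlmostHeisenberg

/-! ### A free field realization of the Virasoro algebra -/

section LightCone

variable {R N : Type*} [CommRing R] [AddCommGroup N] [Module R N]

/-- Two families of operators `a_n`, `b_n`, `n ∈ ℤ`, with `[a_m, b_n] = m δ_{m+n,0}` and all other
commutators zero, such that each vector is killed by `a_n` and `b_n` for large `n`: the modes of a
pair of free bosons in light-cone coordinates. -/
structure IsLightCone (a b : ℤ → Module.End R N) : Prop where
  comm_aa : ∀ (m n : ℤ) (w : N), a m (a n w) = a n (a m w)
  comm_bb : ∀ (m n : ℤ) (w : N), b m (b n w) = b n (b m w)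
  comm_ab : ∀ (m n : ℤ) (w : N),
    a m (b n w) = b n (a m w) + if m + n = 0 then (m : R) • w else 0
  fin : ∀ w : N, ∃ K : ℤ, ∀ n : ℤ, K ≤ n → a n w = 0 ∧ b n w = 0

variable {a b : ℤ → Module.End R N}

/-- The product of `a_p` and `b_q`, with `a_p` on the left if and only if `σ ≥ 0`. For `σ = q` this
is the normally ordered product. -/
def orderedProd (a b : ℤ → Module.End R N) (σ p q : ℤ) : Module.End R N :=
  if 0 ≤ σ then a p * b q else b q * a p

namespace IsLightCone

variable (H : IsLightCone a b)

include H

theorem finite_support (n m : ℤ) (w : N) :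
    (Function.support fun q : ℤ => orderedProd a b q (n - q) (q + m) w).Finite := by
  obtain ⟨K, hK⟩ := H.fin w
  refine (Set.finite_Icc (min 0 (n - K)) (max 0 (K - m))).subset fun q hq => ?_
  rw [Function.mem_support] at hq
  by_contra hq'
  refine hq ?_
  rw [orderedProd]
  rw [Set.mem_Icc] at hq'
  split_ifs with h
  · rw [Module.End.mul_apply, (hK (q + m) (by omega)).2, map_zero]
  · rw [Module.End.mul_apply, (hK (n - q) (by omega)).1, map_zero]

theorem finite_support_smul (n m : ℤ) (f : ℤ → R) (w : N) :
    (Function.support fun q : ℤ => f q • orderedProd a b q (n - q) (q + m) w).Finite :=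
  (H.finite_support n m w).subset (Function.support_smul_subset_right _ _)

theorem finite_support' (n : ℤ) (w : N) :
    (Function.support fun q : ℤ => orderedProd a b q (n - q) q w).Finite := by
  simpa using H.finite_support n 0 w

theorem finite_support_smul' (n : ℤ) (f : ℤ → R) (w : N) :
    (Function.support fun q : ℤ => f q • orderedProd a b q (n - q) q w).Finite := by
  simpa using H.finite_support_smul n 0 f w

/-- The quadratic operator `T_n = ∑_q :a_{n-q} b_q:`. -/
def quadratic (n : ℤ) : Module.End R N where
  toFun w := ∑ᶠ q : ℤ, orderedProd a b q (n - q) q w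
  map_add' x y := by
    simp only [map_add]
    exact finsum_add_distrib (H.finite_support' n x) (H.finite_support' n y)
  map_smul' t x := by
    simp only [map_smul, RingHom.id_apply]
    exact (smul_finsum' t (H.finite_support' n x)).symm

theorem quadratic_apply (n : ℤ) (w : N) :
    H.quadratic n w = ∑ᶠ q : ℤ, orderedProd a b q (n - q) q w := rfl

theorem map_quadratic (n : ℤ) (w : N) (φ : Module.End R N) :
    φ (H.quadratic n w) = ∑ᶠ q : ℤ, φ (orderedProd a b q (n - q) q w) :=
  AddMonoidHom.map_finsum φ.toAddMonoidHom (H.finite_support' n w)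

theorem comm_ba (m n : ℤ) (w : N) :
    b n (a m w) = a m (b n w) - if m + n = 0 then (m : R) • w else 0 := by
  rw [H.comm_ab, add_sub_cancel_right]

theorem quadratic_a (n m : ℤ) (w : N) :
    H.quadratic n (a m w) = a m (H.quadratic n w) - (m : R) • a (n + m) w := by
  rw [H.map_quadratic, H.quadratic_apply, eq_sub_iff_add_eq, ← sub_eq_zero, add_sub_right_comm,
    ← finsum_sub_distrib (H.finite_support' n _)
      ((H.finite_support' n w).subset fun q hq hq' => hq (by simp only [hq', map_zero])),
    finsum_eq_single _ (-m)]
  · simp only [orderedProd]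
    split_ifs
    · simp only [Module.End.mul_apply]
      rw [H.comm_ba, if_pos (by omega), map_sub, map_smul, H.comm_aa m, sub_neg_eq_add]
      abel
    · simp only [Module.End.mul_apply]
      rw [H.comm_aa, H.comm_ba, if_pos (by omega), sub_neg_eq_add]
      abel
  · intro q hq
    simp only [orderedProd]
    split_ifs
    · simp only [Module.End.mul_apply]
      rw [H.comm_ba, if_neg (by omega), sub_zero, H.comm_aa m, sub_self]
    · simp only [Module.End.mul_apply]
      rw [H.comm_aa, H.comm_ba, if_neg (by omega), sub_zero, sub_self]

theorem quadratic_b (n m : ℤ) (w : N) :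
    H.quadratic n (b m w) = b m (H.quadratic n w) - (m : R) • b (n + m) w := by
  rw [H.map_quadratic, H.quadratic_apply, eq_sub_iff_add_eq, ← sub_eq_zero, add_sub_right_comm,
    ← finsum_sub_distrib (H.finite_support' n _)
      ((H.finite_support' n w).subset fun q hq hq' => hq (by simp only [hq', map_zero])),
    finsum_eq_single _ (n + m)]
  · have e : n - (n + m) = -m := by ring
    simp only [orderedProd, e]
    split_ifs
    · simp only [Module.End.mul_apply]
      rw [H.comm_bb, H.comm_ab, if_pos (by omega)]
      push_cast
      module
    · simp only [Module.End.mul_apply]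
      rw [H.comm_ab, if_pos (by omega), map_add, map_smul, H.comm_bb m]
      push_cast
      module
  · intro q hq
    simp only [orderedProd]
    split_ifs
    · simp only [Module.End.mul_apply]
      rw [H.comm_bb, H.comm_ab, if_neg (by omega), add_zero, sub_self]
    · simp only [Module.End.mul_apply]
      rw [H.comm_ab, if_neg (by omega), add_zero, H.comm_bb m, sub_self]

end IsLightCone

theorem sum_Icc_telescope (P : ℤ → ℤ) {x y : ℤ} (h : x ≤ y) :
    ∑ q ∈ Finset.Ico x y, (P (q + 1) - P q) = P y - P x := by
  induction y, h using Int.leInduction with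
  | base => simp
  | succ y hy ih =>
    rw [← Finset.insert_Ico_right_eq_Ico_add_one hy, Finset.sum_insert (by simp), ih]
    ring

/-- The sum producing the central charge. -/
theorem six_mul_sum_reorder (m B : ℤ) (hB : |m| ≤ B) :
    6 * ∑ q ∈ Finset.Ico (-B) B, q * (q + m) *
      ((if 0 ≤ q then 1 else 0) - (if 0 ≤ q + m then 1 else 0)) = m ^ 3 - m := by
  obtain ⟨h1, h2⟩ := abs_le.1 hB
  set P : ℤ → ℤ := fun q => (q - 1) * q * (2 * q - 1) + 3 * m * (q * (q - 1)) with hP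
  have hstep : ∀ q : ℤ, P (q + 1) - P q = 6 * (q * (q + m)) := by intro q; rw [hP]; ring
  have hsum : ∀ x : ℤ, -B ≤ x → x ≤ B →
      ∑ q ∈ Finset.Ico (-B) B, (if x ≤ q then 6 * (q * (q + m)) else 0) = P B - P x := by
    intro x hx hx'
    rw [← Finset.sum_filter, ← sum_Icc_telescope P hx']
    refine Finset.sum_congr ?_ fun q _ => (hstep q).symm
    ext q
    simp only [Finset.mem_filter, Finset.mem_Ico]
    omega
  have e : ∀ q ∈ Finset.Ico (-B) B, 6 * (q * (q + m) *
      ((if 0 ≤ q then 1 else 0) - (if 0 ≤ q + m then 1 else 0))) =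
      (if 0 ≤ q then 6 * (q * (q + m)) else 0) - (if -m ≤ q then 6 * (q * (q + m)) else 0) := by
    intro q _
    have : 0 ≤ q + m ↔ -m ≤ q := by omega
    simp only [this]
    split_ifs <;> ring
  rw [Finset.mul_sum, Finset.sum_congr rfl e, Finset.sum_sub_distrib, hsum 0 (by omega) (by omega),
    hsum (-m) (by omega) (by omega), hP]
  ring

namespace IsLightCone

variable (H : IsLightCone a b)

include H

theorem orderedProd_reorder (σ τ p q : ℤ) (w : N) :
    orderedProd a b σ p q w = orderedProd a b τ p q w +
      (((if 0 ≤ σ then 1 else 0) - (if 0 ≤ τ then 1 else 0) : ℤ) : R) •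
        (if p + q = 0 then (p : R) • w else 0) := by
  unfold orderedProd
  split_ifs with h1 h2 h3 h2 h3 <;>
  simp [Module.End.mul_apply, H.comm_ab, *]

/-- The operators `T_n` satisfy the relations of the Virasoro algebra of central charge `2`. -/
theorem quadratic_comm (m n : ℤ) (w : N) :
    (6 : R) • (H.quadratic m (H.quadratic n w) - H.quadratic n (H.quadratic m w)) =
      (6 : R) • ((m - n : ℤ) : R) • H.quadratic (m + n) w +
        if m + n = 0 then ((m ^ 3 - m : ℤ) : R) • w else 0 := by
  have h1 : H.quadratic m (H.quadratic n w) - H.quadratic n (H.quadratic m w) =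
      ∑ᶠ q : ℤ, (H.quadratic m (orderedProd a b q (n - q) q w) -
        orderedProd a b q (n - q) q (H.quadratic m w)) := by
    rw [H.map_quadratic, H.quadratic_apply n (H.quadratic m w), finsum_sub_distrib]
    · exact (H.finite_support' n w).subset fun q hq hq' => hq (by simp only [hq', map_zero])
    · exact H.finite_support' n _
  have h2 : ∀ q : ℤ, H.quadratic m (orderedProd a b q (n - q) q w) -
        orderedProd a b q (n - q) q (H.quadratic m w) =
      ((q - n : ℤ) : R) • orderedProd a b q (m + n - q) q w +
        ((-q : ℤ) : R) • orderedProd a b q (n - q) (q + m) w := by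
    intro q
    unfold orderedProd
    have e1 : m + (n - q) = m + n - q := by ring
    have e2 : m + q = q + m := by ring
    split_ifs <;> simp only [Module.End.mul_apply, H.quadratic_a, H.quadratic_b, map_sub, map_smul,
      e1, e2] <;> push_cast <;> module
  have h3 : ∀ q : ℤ, ((-q : ℤ) : R) • orderedProd a b q (n - q) (q + m) w =
      ((-q : ℤ) : R) • orderedProd a b (q + m) (m + n - (q + m)) (q + m) w +
      ((q * (q + m) * ((if 0 ≤ q then 1 else 0) - (if 0 ≤ q + m then 1 else 0)) : ℤ) : R) •
        (if m + n = 0 then w else 0) := by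
    intro q
    rw [H.orderedProd_reorder q (q + m)]
    have e1 : m + n - (q + m) = n - q := by ring
    have e2 : n - q + (q + m) = m + n := by ring
    rw [e1, e2]
    by_cases h : m + n = 0
    · obtain rfl : n = -m := by omega
      simp only [h, if_true]
      push_cast
      module
    · simp [h]
  have hfin : (Function.support fun q : ℤ =>
      ((q * (q + m) * ((if 0 ≤ q then 1 else 0) - (if 0 ≤ q + m then 1 else 0)) : ℤ) : R) •
        (if m + n = 0 then w else 0)) ⊆ (Finset.Ico (-|m|) |m| : Finset ℤ) := by
    intro q hq
    rw [Function.mem_support] at hq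
    by_contra hq'
    refine hq ?_
    rw [Finset.mem_coe, Finset.mem_Ico] at hq'
    have : (if 0 ≤ q then (1 : ℤ) else 0) - (if 0 ≤ q + m then 1 else 0) = 0 := by
      rcases abs_cases m with ⟨h, _⟩ | ⟨h, _⟩ <;> rw [h] at hq' <;> split_ifs <;> omega
    rw [this, mul_zero, Int.cast_zero, zero_smul]
  have hfin' : (Function.support fun q : ℤ =>
      ((-q : ℤ) : R) • orderedProd a b (q + m) (m + n - (q + m)) (q + m) w).Finite := by
    have := (H.finite_support_smul' (m + n) (fun q => ((-(q - m) : ℤ) : R)) w).preimage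
      (Equiv.addRight m).injective.injOn
    refine this.subset fun q hq => ?_
    simpa using hq
  have h4 : ∑ᶠ q : ℤ, ((-q : ℤ) : R) • orderedProd a b (q + m) (m + n - (q + m)) (q + m) w =
      ∑ᶠ q : ℤ, ((m - q : ℤ) : R) • orderedProd a b q (m + n - q) q w := by
    rw [← finsum_comp_equiv (Equiv.addRight m)
      (f := fun q : ℤ => ((m - q : ℤ) : R) • orderedProd a b q (m + n - q) q w)]
    refine finsum_congr fun q => ?_
    simp only [Equiv.coe_addRight]
    congr 2
    ring
  rw [h1, finsum_congr h2, finsum_add_distrib (H.finite_support_smul' _ _ w)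
    (H.finite_support_smul n m _ w), finsum_congr h3, finsum_add_distrib hfin'
    ((Finset.finite_toSet _).subset hfin), h4, ← add_assoc, ← finsum_add_distrib
    (H.finite_support_smul' _ _ w) (H.finite_support_smul' _ _ w),
    finsum_eq_sum_of_support_subset _ hfin, ← Finset.sum_smul, ← Int.cast_sum, smul_add]
  congr 1
  · rw [H.quadratic_apply, smul_finsum' _ (H.finite_support' _ w)]
    congr 1
    refine finsum_congr fun q => ?_
    push_cast
    module
  · rw [smul_smul]
    have := congrArg (Int.cast : ℤ → R) (six_mul_sum_reorder m |m| le_rfl)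
    rw [Int.cast_mul, Int.cast_ofNat] at this
    rw [this, smul_ite, smul_zero]

end IsLightCone

end LightCone

/-! ### Background charge and the Fock representation -/

namespace IsLightCone

variable {R N : Type*} [CommRing R] [AddCommGroup N] [Module R N] {a b : ℤ → Module.End R N}
  (H : IsLightCone a b)

include H

/-- The operator `T_n + (n + 1) (a_n + ν b_n)`: the quadratic operator with a background charge. -/
def virasoroMode (ν : R) (n : ℤ) : Module.End R N :=
  H.quadratic n + ((n + 1 : ℤ) : R) • (a n + ν • b n)

/-- The background charge changes the central charge from `2` to `κ = 2 - 24 ν`. -/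
theorem virasoroMode_comm [Algebra ℂ R] {ν κ : R} (hν : κ = 2 - 24 * ν) (m n : ℤ) :
    H.virasoroMode ν m * H.virasoroMode ν n - H.virasoroMode ν n * H.virasoroMode ν m =
      ((m - n : ℤ) : R) • H.virasoroMode ν (m + n) +
        (if m + n = 0 then algebraMap ℂ R (((m : ℂ) ^ 3 - m) / 12) * κ else 0) • 1 := by
  ext w
  have e12 : algebraMap ℂ R 12⁻¹ * 12 = 1 := by
    rw [← map_ofNat (algebraMap ℂ R) 12, ← map_mul]; norm_num
  have key : (12 : R) • ((H.virasoroMode ν m * H.virasoroMode ν n -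
      H.virasoroMode ν n * H.virasoroMode ν m) w) =
      (12 : R) • ((((m - n : ℤ) : R) • H.virasoroMode ν (m + n) +
        (if m + n = 0 then algebraMap ℂ R (((m : ℂ) ^ 3 - m) / 12) * κ else 0) •
          (1 : Module.End R N)) w) := by
    have h := congrArg ((2 : R) • ·) (H.quadratic_comm m n w)
    simp only [virasoroMode, LinearMap.sub_apply, Module.End.mul_apply, LinearMap.add_apply,
      LinearMap.smul_apply, map_add, map_smul, H.quadratic_a, H.quadratic_b, Module.End.one_apply,
      H.comm_ab, H.comm_aa m n, H.comm_bb m n, add_comm n m] at h ⊢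
    by_cases h0 : m + n = 0
    · obtain rfl : n = -m := by omega
      have e : (12 : R) * algebraMap ℂ R (((m : ℂ) ^ 3 - m) / 12) = (m : R) ^ 3 - m := by
        rw [← map_ofNat (algebraMap ℂ R) 12, ← map_mul, mul_div_cancel₀ _ (by norm_num)]
        simp
      rw [if_pos h0] at h
      simp only [h0, if_true]
      rw [hν, smul_add (12 : R), smul_smul (12 : R) (_ * _) w, ← mul_assoc, e]
      rw [← sub_eq_zero] at h ⊢
      rw [← h, h0]
      push_cast
      module
    · rw [if_neg h0] at h
      simp only [h0, if_false]
      rw [← sub_eq_zero] at h ⊢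
      rw [← h]
      push_cast
      module
  have := congrArg (algebraMap ℂ R 12⁻¹ • ·) key
  simpa only [smul_smul, e12, one_smul] using this

end IsLightCone

section Lift

attribute [local instance] LieRing.ofAssociativeRing

variable {R N : Type*} [CommRing R] [AddCommGroup N] [Module R N]

/-- The linear extension to the Virasoro algebra of `L_n ↦ L n`, `c ↦ κ`. -/
def virasoroLinear (L : ℤ → Module.End R N) (κ : R) : Virasoro R →ₗ[R] Module.End R N :=
  LinearMap.coprod (M := ℤ →₀ R) (M₂ := R) (Finsupp.linearCombination R L)
    (LinearMap.toSpanSingleton R _ (κ • 1))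

variable [Algebra ℂ R]

theorem virasoroLinear_comm {L : ℤ → Module.End R N} {κ : R}
    (hL : ∀ m n : ℤ, L m * L n - L n * L m = ((m - n : ℤ) : R) • L (m + n) +
      (if m + n = 0 then algebraMap ℂ R (((m : ℂ) ^ 3 - m) / 12) * κ else 0) • 1)
    (x y : ℤ →₀ R) :
    Finsupp.linearCombination R L x * Finsupp.linearCombination R L y -
      Finsupp.linearCombination R L y * Finsupp.linearCombination R L x =
    Finsupp.linearCombination R L (Virasoro.witt R x y) + Virasoro.cocycle R x y • κ • 1 := by
  induction x using Finsupp.induction_linear with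
  | zero => simp
  | add f g hf hg =>
    simp only [map_add, LinearMap.add_apply, add_mul, mul_add, add_smul]
    rw [add_sub_add_comm, hf, hg]
    abel
  | single m s =>
    induction y using Finsupp.induction_linear with
    | zero => simp
    | add f g hf hg =>
      simp only [map_add, add_mul, mul_add, add_smul]
      rw [add_sub_add_comm, hf, hg]
      abel
    | single n t =>
      rw [Virasoro.witt_single, Virasoro.cocycle_single]
      simp only [Finsupp.linearCombination_single]
      rw [smul_mul_smul_comm, smul_mul_smul_comm, mul_comm t s, ← smul_sub, hL]
      split_ifs <;> module

/-- A family of operators satisfying the Virasoro relations defines a representation. -/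
def virasoroHom (L : ℤ → Module.End R N) (κ : R)
    (hL : ∀ m n : ℤ, L m * L n - L n * L m = ((m - n : ℤ) : R) • L (m + n) +
      (if m + n = 0 then algebraMap ℂ R (((m : ℂ) ^ 3 - m) / 12) * κ else 0) • 1) :
    Virasoro R →ₗ⁅R⁆ Module.End R N :=
  { virasoroLinear L κ with
    map_lie' := by
      rintro ⟨x, s⟩ ⟨y, t⟩
      change Finsupp.linearCombination R L (Virasoro.witt R x y) +
          Virasoro.cocycle R x y • κ • (1 : Module.End R N) =
        (Finsupp.linearCombination R L x + s • κ • 1) *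
          (Finsupp.linearCombination R L y + t • κ • 1) -
        (Finsupp.linearCombination R L y + t • κ • 1) *
          (Finsupp.linearCombination R L x + s • κ • 1)
      rw [← virasoroLinear_comm hL]
      simp only [add_mul, mul_add, mul_smul_comm, smul_mul_assoc, mul_one, one_mul]
      module }

theorem virasoroHom_L (L : ℤ → Module.End R N) (κ : R) (hL) (n : ℤ) :
    virasoroHom L κ hL (Virasoro.L R n) = L n := by
  change Finsupp.linearCombination R L (Finsupp.single n 1) +
    (0 : R) • κ • (1 : Module.End R N) = L n
  simp

theorem virasoroHom_central (L : ℤ → Module.End R N) (κ : R) (hL) :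
    virasoroHom L κ hL (Virasoro.central R) = κ • 1 := by
  change Finsupp.linearCombination R L 0 + (1 : R) • κ • (1 : Module.End R N) = κ • 1
  simp

/-- If some representation of central charge `κ` contains a torsion-free vector with the eigenvalues
of the irregular vector, then the irregular vector is torsion-free. -/
theorem eq_zero_of_smul_irregularVector_of_rep {r : ℕ} {κ Q : R} {c : ℕ → R}
    (L : ℤ → Module.End R N)
    (hL : ∀ m n : ℤ, L m * L n - L n * L m = ((m - n : ℤ) : R) • L (m + n) +
      (if m + n = 0 then algebraMap ℂ R (((m : ℂ) ^ 3 - m) / 12) * κ else 0) • 1)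
    (u : N) (hu : ∀ n : ℕ, r - 1 ≤ n → L n u = baseEigenvalue r Q c n • u)
    (htf : ∀ t : R, t • u = 0 → t = 0) (t : R) (ht : t • irregularVector r κ Q c = 0) : t = 0 := by
  set ρ := UniversalEnvelopingAlgebra.lift R (virasoroHom L κ hL) with hρ
  have key : ∀ x ∈ irregularIdeal r κ Q c, ρ x u = 0 := by
    intro x hx
    induction hx using Submodule.span_induction with
    | mem x hx =>
      rcases hx with ⟨n, hn, rfl⟩ | hx
      · rw [map_sub, AlgHom.commutes, mode, hρ, UniversalEnvelopingAlgebra.lift_ι_apply,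
          virasoroHom_L, LinearMap.sub_apply, hu n hn, Module.algebraMap_end_apply, sub_self]
      · rw [Set.mem_singleton_iff] at hx
        rw [hx, map_sub, AlgHom.commutes, hρ, UniversalEnvelopingAlgebra.lift_ι_apply,
          virasoroHom_central, LinearMap.sub_apply, Module.algebraMap_end_apply,
          LinearMap.smul_apply, Module.End.one_apply, sub_self]
    | zero => simp
    | add x y _ _ hx hy => rw [map_add, LinearMap.add_apply, hx, hy, add_zero]
    | smul x y _ hy => rw [smul_eq_mul, map_mul, Module.End.mul_apply, hy, map_zero]
  rw [irregularVector, ← Submodule.Quotient.mk_smul, Submodule.Quotient.mk_eq_zero] at ht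
  have := key _ ht
  rw [map_smul, map_one, LinearMap.smul_apply, Module.End.one_apply] at this
  exact htf t this

end Lift

section Fock

variable {R : Type*} [CommRing R]

/-- The Fock space of two free bosons: polynomials in the variables `X (σ, n)`, of which the ones
with `n ≥ 1` play a role. The operator `fockMode σ γ n` is multiplication by `X (σ, -n)` for
`n < 0`, and `n ∂ / ∂X (¬ σ, n) + γ n` for `n ≥ 0`, so that the constant polynomials have
eigenvalue `γ n`. -/
def fockMode (σ : Bool) (γ : ℤ → R) (n : ℤ) : Module.End R (MvPolynomial (Bool × ℤ) R) :=
  if n < 0 then LinearMap.mulLeft R (MvPolynomial.X (σ, -n))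
  else (n : R) • (MvPolynomial.pderiv (!σ, n)).toLinearMap + γ n • 1

theorem fockMode_comm (σ τ : Bool) (γ δ : ℤ → R) (m n : ℤ) (w : MvPolynomial (Bool × ℤ) R) :
    fockMode σ γ m (fockMode τ δ n w) = fockMode τ δ n (fockMode σ γ m w) +
      if τ = !σ ∧ m + n = 0 then (m : R) • w else 0 := by
  unfold fockMode
  by_cases hm : m < 0 <;> by_cases hn : n < 0
  · rw [if_pos hm, if_pos hn, if_neg (by omega), add_zero]
    simp only [LinearMap.mulLeft_apply]
    ring
  · rw [if_pos hm, if_neg hn]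
    simp only [LinearMap.mulLeft_apply, LinearMap.add_apply, LinearMap.smul_apply,
      Module.End.one_apply, Derivation.coeFn_coe,
      MvPolynomial.pderiv_mul]
    by_cases h : τ = !σ ∧ m + n = 0
    · obtain ⟨rfl, h⟩ := h
      obtain rfl : n = -m := by omega
      rw [Bool.not_not, MvPolynomial.pderiv_X_self, if_pos ⟨rfl, h⟩]
      simp only [MvPolynomial.smul_eq_C_mul]
      push_cast
      simp only [map_neg]
      ring
    · rw [if_neg h, MvPolynomial.pderiv_X_of_ne]
      · simp only [MvPolynomial.smul_eq_C_mul]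
        ring
      · rintro h'
        rw [Prod.mk.injEq] at h'
        refine h ⟨by rw [h'.1, Bool.not_not], by omega⟩
  · rw [if_neg hm, if_pos hn]
    simp only [LinearMap.mulLeft_apply, LinearMap.add_apply, LinearMap.smul_apply,
      Module.End.one_apply, Derivation.coeFn_coe,
      MvPolynomial.pderiv_mul]
    by_cases h : τ = !σ ∧ m + n = 0
    · obtain ⟨rfl, h⟩ := h
      obtain rfl : n = -m := by omega
      rw [neg_neg, MvPolynomial.pderiv_X_self, if_pos ⟨rfl, h⟩]
      simp only [MvPolynomial.smul_eq_C_mul]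
      ring
    · rw [if_neg h, MvPolynomial.pderiv_X_of_ne]
      · simp only [MvPolynomial.smul_eq_C_mul]
        ring
      · rintro h'
        rw [Prod.mk.injEq] at h'
        refine h ⟨h'.1, by omega⟩
  · rw [if_neg hm, if_neg hn]
    have h0 : (if τ = !σ ∧ m + n = 0 then (m : R) • w else 0) = 0 := by
      split_ifs with h
      · obtain rfl : m = 0 := by omega
        simp
      · rfl
    have hp : ∀ i j : Bool × ℤ, MvPolynomial.pderiv i (MvPolynomial.pderiv j w) =
        MvPolynomial.pderiv j (MvPolynomial.pderiv i w) := by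
      intro i j
      have : ⁅(MvPolynomial.pderiv i : Derivation R (MvPolynomial (Bool × ℤ) R) _),
          (MvPolynomial.pderiv j : Derivation R (MvPolynomial (Bool × ℤ) R) _)⁆ = 0 := by
        classical
        refine MvPolynomial.derivation_ext fun k => ?_
        rw [Derivation.commutator_apply, MvPolynomial.pderiv_X, MvPolynomial.pderiv_X,
          Pi.single_apply, Pi.single_apply]
        split_ifs <;> simp
      have := DFunLike.congr_fun this w
      rw [Derivation.commutator_apply, Derivation.coe_zero, Pi.zero_apply] at this
      exact sub_eq_zero.1 this
    rw [h0]
    simp only [LinearMap.add_apply, LinearMap.smul_apply, Module.End.one_apply,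
      Derivation.coeFn_coe, map_add, Derivation.map_smul]
    rw [hp]
    module

theorem fockMode_isLightCone {α β : ℤ → R} {K : ℤ} (hα : ∀ n, K ≤ n → α n = 0)
    (hβ : ∀ n, K ≤ n → β n = 0) : IsLightCone (fockMode false α) (fockMode true β) where
  comm_aa m n w := by rw [fockMode_comm]; simp
  comm_bb m n w := by rw [fockMode_comm]; simp
  comm_ab m n w := by rw [fockMode_comm]; simp
  fin w := by
    obtain ⟨B, hB⟩ := (w.vars.image Prod.snd).bddAbove
    refine ⟨max (max 0 K) (B + 1), fun n hn => ?_⟩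
    have h : ∀ σ : Bool, MvPolynomial.pderiv (σ, n) w = 0 := by
      intro σ
      refine MvPolynomial.pderiv_eq_zero_of_notMem_vars fun h => ?_
      have := hB (Finset.mem_coe.2 (Finset.mem_image_of_mem Prod.snd h))
      simp only at this
      omega
    simp [fockMode, h, hα n (by omega), hβ n (by omega), show ¬ n < 0 by omega]

theorem fockMode_one (σ : Bool) (γ : ℤ → R) {n : ℤ} (hn : 0 ≤ n) :
    fockMode σ γ n 1 = γ n • (1 : MvPolynomial (Bool × ℤ) R) := by
  simp [fockMode, not_lt.2 hn]

/-- The irregular vector generates a free `R`-module. It is realized as the vacuum of a Fock space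
in which `b_{r-1}` and the `a_n`, `0 ≤ n ≤ r - 1`, have prescribed eigenvalues. -/
theorem eq_zero_of_smul_irregularVector [Algebra ℂ R] {r : ℕ} (hr : 2 ≤ r) {κ Q : R} {c : ℕ → R}
    (t : R) (ht : t • irregularVector r κ Q c = 0) : t = 0 := by
  set ν : R := algebraMap ℂ R 24⁻¹ * (2 - κ) with hν
  have e24 : κ = 2 - 24 * ν := by
    have : 24 * algebraMap ℂ R 24⁻¹ = 1 := by
      rw [← map_ofNat (algebraMap ℂ R) 24, ← map_mul]; norm_num
    rw [hν, ← mul_assoc, this]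
    ring
  set χ := baseEigenvalue r Q c with hχ
  -- The vacuum has `L_n`-eigenvalue `α (n - r + 1) + (n + 1) (α n + ν β n)` for `n ≥ r - 1`.
  set β : ℤ → R := fun n => if n = (r : ℤ) - 1 then 1 else 0 with hβ
  set α : ℤ → R := fun n =>
    if n = 0 then χ (r - 1) - r * (χ (2 * r - 2) + ν)
    else if 0 < n ∧ n < r then χ (n + (r - 1)).toNat else 0 with hα
  have hα0 : ∀ n : ℤ, r ≤ n → α n = 0 := by
    intro n hn
    simp only [hα]
    rw [if_neg (by omega), if_neg (by omega)]
  have hβ0 : ∀ n : ℤ, r ≤ n → β n = 0 := by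
    intro n hn
    simp only [hβ]
    rw [if_neg (by omega)]
  have H := fockMode_isLightCone hα0 hβ0
  refine eq_zero_of_smul_irregularVector_of_rep _ (H.virasoroMode_comm e24) 1 (fun n hn => ?_)
    (fun t ht => ?_) t ht
  · have hq : H.quadratic n 1 = α (n - r + 1) • (1 : MvPolynomial (Bool × ℤ) R) := by
      rw [H.quadratic_apply, finsum_eq_single _ ((r : ℤ) - 1)]
      · rw [orderedProd, if_pos (by omega), Module.End.mul_apply, fockMode_one _ _ (by omega),
          map_smul, fockMode_one _ _ (by omega)]
        simp only [hβ, if_true, one_smul]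
        congr 2
        ring
      · intro q hq
        rw [orderedProd]
        split_ifs with h
        · rw [Module.End.mul_apply, fockMode_one _ _ h]
          simp only [hβ, if_neg hq, zero_smul, map_zero]
        · rw [Module.End.mul_apply, fockMode_one _ _ (by omega), hα0 _ (by omega), zero_smul,
            map_zero]
    have heig : α (n - r + 1) + ((n + 1 : ℤ) : R) * (α n + ν * β n) = χ n := by
      rcases hn.eq_or_lt with rfl | hn'
      · have e1 : (((r - 1 : ℕ) : ℤ)) - r + 1 = 0 := by omega
        have e2 : (((r - 1 : ℕ) : ℤ) + (r - 1)).toNat = 2 * r - 2 := by omega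
        have e3 : ((((r - 1 : ℕ) : ℤ) + 1 : ℤ) : R) = r := by
          rw [show (((r - 1 : ℕ) : ℤ) + 1 : ℤ) = (r : ℤ) by omega, Int.cast_natCast]
        rw [e1, e3]
        simp only [hα, hβ]
        rw [if_pos True.intro, if_neg (by omega), if_pos (by omega), if_pos (by omega), e2]
        ring
      · rw [hα0 n (by omega), hβ0 n (by omega), mul_zero, add_zero, mul_zero, add_zero]
        simp only [hα]
        rw [if_neg (by omega)]
        split_ifs with h
        · congr 1
          omega
        · -- all the eigenvalues with `n > 2r - 2` vanish
          rw [hχ, baseEigenvalue, if_neg (by omega), zero_sub, eq_comm, neg_eq_zero]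
          refine Finset.sum_eq_zero fun p hp => Finset.sum_eq_zero fun q hq => if_neg ?_
          rw [Finset.mem_Icc] at hp hq
          omega
    rw [IsLightCone.virasoroMode, LinearMap.add_apply, hq, LinearMap.smul_apply,
      LinearMap.add_apply, LinearMap.smul_apply, fockMode_one _ _ (by omega),
      fockMode_one _ _ (by omega), ← hχ, ← heig]
    module
  · rw [MvPolynomial.smul_eq_C_mul, mul_one] at ht
    exact MvPolynomial.C_eq_zero.1 ht

end Fock

/-! ### The structure of the irregular Verma module -/

section Verma

attribute [local instance] LieRing.ofAssociativeRing

variable {R : Type*} [CommRing R]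

theorem adjoin_range_ι_eq_top (A : Type*) [LieRing A] [LieAlgebra R A] :
    Algebra.adjoin R (Set.range (UniversalEnvelopingAlgebra.ι R : A → _)) = ⊤ := by
  have h : Function.Surjective (UniversalEnvelopingAlgebra.mkAlgHom R A) :=
    RingCon.mkₐ_surjective _
  have e : (UniversalEnvelopingAlgebra.ι R : A → _) =
      UniversalEnvelopingAlgebra.mkAlgHom R A ∘ TensorAlgebra.ι R :=
    funext fun x => UniversalEnvelopingAlgebra.ι_apply ..
  rw [e, Set.range_comp, ← AlgHom.map_adjoin, TensorAlgebra.adjoin_range_ι, Algebra.map_top,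
    AlgHom.range_eq_top]
  exact h

variable {r : ℕ} {κ Q : R} {c : ℕ → R}

theorem baseEigenvalue_eq_zero (hr : 2 ≤ r) {n : ℕ} (hn : 2 * r - 2 < n) :
    baseEigenvalue r Q c n = 0 := by
  rw [baseEigenvalue, if_neg (by omega), zero_sub, neg_eq_zero]
  refine Finset.sum_eq_zero fun p hp => Finset.sum_eq_zero fun q hq => if_neg ?_
  rw [Finset.mem_Icc] at hp hq
  omega

theorem baseEigenvalue_top (hr : 2 ≤ r) : baseEigenvalue r Q c (2 * r - 2) = -c (r - 1) ^ 2 := by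
  rw [baseEigenvalue, if_neg (by omega), zero_sub, Finset.sum_eq_single (r - 1),
    Finset.sum_eq_single (r - 1), if_pos (by omega), sq]
  · intro q hq hq'
    rw [Finset.mem_Icc] at hq
    exact if_neg (by omega)
  · simp only [Finset.mem_Icc]
    omega
  · intro p hp hp'
    refine Finset.sum_eq_zero fun q hq => if_neg ?_
    rw [Finset.mem_Icc] at hp hq
    omega
  · simp only [Finset.mem_Icc]
    omega

variable (R) in
/-- The inclusion of the span of the modes `L_n` into the Virasoro algebra. -/
def wittInclusion : (ℤ →₀ R) →ₗ[R] Virasoro R := LinearMap.inl R (ℤ →₀ R) R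

theorem wittInclusion_single (n : ℤ) (a : R) :
    wittInclusion R (Finsupp.single n a) = a • Virasoro.L R n := by
  refine Prod.ext ?_ (mul_zero a).symm
  change Finsupp.single n a = a • Finsupp.single n 1
  rw [Finsupp.smul_single, smul_eq_mul, mul_one]

theorem eq_wittInclusion_add (y : Virasoro R) :
    y = wittInclusion R y.1 + y.2 • Virasoro.central R := by
  refine Prod.ext ?_ ?_
  · change y.1 = y.1 + y.2 • 0
    rw [smul_zero, add_zero]
  · change y.2 = 0 + y.2 * 1
    rw [zero_add, mul_one]

variable [Algebra ℂ R]

theorem lie_L_L (m n : ℤ) : ⁅Virasoro.L R m, Virasoro.L R n⁆ =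
    ((m - n : ℤ) : R) • Virasoro.L R (m + n) +
      (if m + n = 0 then algebraMap ℂ R (((m : ℂ) ^ 3 - m) / 12) else 0) • Virasoro.central R := by
  refine Prod.ext ?_ ?_
  · change Virasoro.witt R (Finsupp.single m 1) (Finsupp.single n 1) =
      ((m - n : ℤ) : R) • Finsupp.single (m + n) 1 + _ • 0
    rw [Virasoro.witt_single, smul_zero, add_zero, Finsupp.smul_single, smul_eq_mul, one_mul,
      one_mul, mul_one]
  · change Virasoro.cocycle R (Finsupp.single m 1) (Finsupp.single n 1) =
      ((m - n : ℤ) : R) • 0 + _ • 1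
    rw [Virasoro.cocycle_single, smul_zero, zero_add, smul_eq_mul, one_mul, one_mul, mul_one]

theorem lie_central (x : Virasoro R) : ⁅Virasoro.central R, x⁆ = 0 := by
  refine Prod.ext ?_ ?_
  · change Virasoro.witt R 0 x.1 = 0
    rw [map_zero, LinearMap.zero_apply]
  · change Virasoro.cocycle R 0 x.1 = 0
    rw [map_zero, LinearMap.zero_apply]

theorem ι_central_mul (u : UVir R) :
    UniversalEnvelopingAlgebra.ι R (Virasoro.central R) * u =
      u * UniversalEnvelopingAlgebra.ι R (Virasoro.central R) := by
  have hu : u ∈ Algebra.adjoin R (Set.range (UniversalEnvelopingAlgebra.ι R : Virasoro R → _)) := by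
    rw [adjoin_range_ι_eq_top]; trivial
  induction hu using Algebra.adjoin_induction with
  | mem u hu =>
    obtain ⟨x, rfl⟩ := hu
    rw [← sub_eq_zero, ← LieRing.of_associative_ring_bracket, ← LieHom.map_lie, lie_central,
      map_zero]
  | algebraMap t => exact (Algebra.commutes _ _).symm
  | add u v _ _ hu hv => rw [mul_add, add_mul, hu, hv]
  | mul u v _ _ hu hv => rw [← mul_assoc, hu, mul_assoc, hv, mul_assoc]

theorem ι_central_smul (v : IrregularVerma r κ Q c) :
    UniversalEnvelopingAlgebra.ι R (Virasoro.central R) • v = κ • v := by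
  obtain ⟨u, rfl⟩ := Submodule.Quotient.mk_surjective _ v
  rw [← Submodule.Quotient.mk_smul, ← Submodule.Quotient.mk_smul, Submodule.Quotient.eq,
    smul_eq_mul, ι_central_mul, Algebra.smul_def, Algebra.commutes, ← mul_sub]
  exact Submodule.smul_mem _ u (Submodule.subset_span (Or.inr rfl))

variable (r κ Q c) in
/-- The action of `L_n` on the irregular Verma module as an `R`-linear map. -/
def modeEnd (n : ℤ) : Module.End R (IrregularVerma r κ Q c) :=
  Algebra.lsmul R R (IrregularVerma r κ Q c) (mode R n)

theorem modeEnd_apply (n : ℤ) (v : IrregularVerma r κ Q c) :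
    modeEnd r κ Q c n v = mode R n • v := rfl

theorem modeEnd_comm (m n : ℤ) (v : IrregularVerma r κ Q c) :
    modeEnd r κ Q c m (modeEnd r κ Q c n v) = modeEnd r κ Q c n (modeEnd r κ Q c m v) +
      (((m - n : ℤ) : R) • modeEnd r κ Q c (m + n) v +
        (if m + n = 0 then algebraMap ℂ R (((m : ℂ) ^ 3 - m) / 12) else 0) • κ • v) := by
  have h : mode R m * mode R n - mode R n * mode R m = ((m - n : ℤ) : R) • mode R (m + n) +
      (if m + n = 0 then algebraMap ℂ R (((m : ℂ) ^ 3 - m) / 12) else 0) •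
        UniversalEnvelopingAlgebra.ι R (Virasoro.central R) := by
    simp only [mode]
    rw [← LieRing.of_associative_ring_bracket, ← LieHom.map_lie, lie_L_L, map_add, map_smul,
      map_smul]
  simp only [modeEnd_apply, ← mul_smul]
  rw [← sub_eq_iff_eq_add', ← sub_smul, h, add_smul, smul_assoc, smul_assoc, ι_central_smul,
    mul_smul _ κ v]

theorem mode_smul_irregularVector {n : ℕ} (hn : r - 1 ≤ n) :
    modeEnd r κ Q c n (irregularVector r κ Q c) =
      baseEigenvalue r Q c n • irregularVector r κ Q c := by
  rw [modeEnd_apply, irregularVector, ← Submodule.Quotient.mk_smul, ← Submodule.Quotient.mk_smul,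
    Submodule.Quotient.eq]
  refine Submodule.subset_span (Or.inl ⟨n, hn, ?_⟩)
  rw [smul_eq_mul, mul_one, Algebra.smul_def, mul_one]

variable (r Q c) in
/-- The eigenvalue of `L_n` on the irregular vector for `n ≥ r - 1`, extended by zero. -/
def extEigenvalue (n : ℤ) : R := if (r : ℤ) - 1 ≤ n then baseEigenvalue r Q c n.toNat else 0

variable (r κ Q c) in
/-- The operators `Z_i = L_{r-1+i} - Λ'_{r-1+i}`, where `Λ'_n` is read as zero for `n < r - 1`. -/
def shiftedMode (i : ℤ) : Module.End R (IrregularVerma r κ Q c) :=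
  modeEnd r κ Q c (r - 1 + i) - extEigenvalue r Q c (r - 1 + i) • 1

/-- The shifted modes satisfy the canonical commutation relations of level `-2 c_{r-1}²` up to terms
of lower degree; the central term comes from the eigenvalue of `L_{2r-2}`. -/
theorem isAlmostHeisenberg (hr : 2 ≤ r) :
    IsAlmostHeisenberg (shiftedMode r κ Q c) (irregularVector r κ Q c) (r - 1)
      (fun i j => ((i - j : ℤ) : R) * extEigenvalue r Q c (2 * (r - 1) + i + j) +
        (if 2 * ((r : ℤ) - 1) + i + j = 0 then
          algebraMap ℂ R ((((r - 1 + i : ℤ) : ℂ) ^ 3 - (r - 1 + i : ℤ)) / 12) else 0) * κ)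
      (-2 * c (r - 1) ^ 2) where
  one_le := by omega
  vac i hi := by
    rw [shiftedMode, LinearMap.sub_apply, extEigenvalue, if_pos (by omega)]
    obtain ⟨n, hn⟩ := Int.eq_ofNat_of_zero_le (show 0 ≤ (r : ℤ) - 1 + i by omega)
    rw [hn, mode_smul_irregularVector (by omega), Int.toNat_natCast, LinearMap.smul_apply,
      Module.End.one_apply, sub_self]
  comm i j w := by
    simp only [shiftedMode, LinearMap.sub_apply, LinearMap.smul_apply, Module.End.one_apply,
      map_sub, map_smul]
    rw [modeEnd_comm]
    have e1 : (r : ℤ) - 1 + (i + j + (r - 1)) = 2 * (r - 1) + i + j := by ring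
    have e2 : (r : ℤ) - 1 + i + (r - 1 + j) = 2 * (r - 1) + i + j := by ring
    have e3 : (r : ℤ) - 1 + i - (r - 1 + j) = i - j := by ring
    rw [e1, e2, e3]
    module
  ξ_of_pos i j hij := by
    rw [if_neg (by omega), extEigenvalue, if_pos (by omega), baseEigenvalue_eq_zero hr (by omega)]
    ring
  ξ_neg i := by
    rw [if_neg (by omega), extEigenvalue, if_pos (by omega),
      show (2 * ((r : ℤ) - 1) + i + -i).toNat = 2 * r - 2 by omega, baseEigenvalue_top hr]
    push_cast
    ring

theorem exists_mem_wordFiltration (hr : 2 ≤ r) (v : IrregularVerma r κ Q c) :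
    ∃ d : ℕ, v ∈ wordFiltration (shiftedMode r κ Q c) (irregularVector r κ Q c) d := by
  set F := wordFiltration (shiftedMode r κ Q c) (irregularVector r κ Q c) with hF
  have H := isAlmostHeisenberg (κ := κ) (Q := Q) (c := c) hr
  have hadd : ∀ {x y}, (∃ d : ℕ, x ∈ F d) → (∃ d : ℕ, y ∈ F d) → ∃ d : ℕ, x + y ∈ F d := by
    rintro x y ⟨d, hd⟩ ⟨e, he⟩
    exact ⟨max d e, add_mem (wordFiltration_mono (by simp) hd) (wordFiltration_mono (by simp) he)⟩
  have hsmul : ∀ (t : R) {x}, (∃ d : ℕ, x ∈ F d) → ∃ d : ℕ, t • x ∈ F d :=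
    fun t x ⟨d, hd⟩ => ⟨d, Submodule.smul_mem _ t hd⟩
  have hmode : ∀ (n : ℤ) {x}, (∃ d : ℕ, x ∈ F d) → ∃ d : ℕ, modeEnd r κ Q c n x ∈ F d := by
    rintro n x hx
    obtain ⟨d, hd⟩ := hx
    have h1 := H.apply_mem (i := n - (r - 1)) hd
    have h2 : modeEnd r κ Q c n x = shiftedMode r κ Q c (n - (r - 1)) x +
        extEigenvalue r Q c n • x := by
      simp [shiftedMode]
    rw [h2]
    refine hadd ⟨(d - (n - (r - 1)) : ℤ).toNat, ?_⟩ (hsmul _ ⟨d, hd⟩)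
    exact wordFiltration_mono (Int.self_le_toNat _) h1
  have key : ∀ u : UVir R, ∀ {x}, (∃ d : ℕ, x ∈ F d) → ∃ d : ℕ, u • x ∈ F d := by
    intro u
    have hu : u ∈ Algebra.adjoin R
        (Set.range (UniversalEnvelopingAlgebra.ι R : Virasoro R → _)) := by
      rw [adjoin_range_ι_eq_top]; trivial
    induction hu using Algebra.adjoin_induction with
    | mem u hu =>
      obtain ⟨y, rfl⟩ := hu
      intro x hx
      have hf : ∀ f : ℤ →₀ R, ∃ d : ℕ,
          UniversalEnvelopingAlgebra.ι R (wittInclusion R f) • x ∈ F d := by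
        intro f
        induction f using Finsupp.induction_linear with
        | zero => exact ⟨0, by rw [map_zero, map_zero, zero_smul]; exact zero_mem _⟩
        | add f g hf hg =>
          rw [map_add, map_add, add_smul]
          exact hadd hf hg
        | single n a =>
          rw [wittInclusion_single, map_smul, smul_assoc]
          exact hsmul _ (hmode n hx)
      rw [eq_wittInclusion_add y, map_add, add_smul, map_smul, smul_assoc, ι_central_smul]
      exact hadd (hf _) (hsmul _ (hsmul _ hx))
    | algebraMap t =>
      intro x hx
      rw [algebraMap_smul]
      exact hsmul t hx
    | add u v _ _ hu hv =>
      intro x hx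
      rw [add_smul]
      exact hadd (hu hx) (hv hx)
    | mul u v _ _ hu hv =>
      intro x hx
      rw [mul_smul]
      exact hu (hv hx)
  obtain ⟨u, rfl⟩ := Submodule.Quotient.mk_surjective _ v
  have := key u ⟨0, vac_mem_wordFiltration le_rfl⟩
  rwa [irregularVector, ← Submodule.Quotient.mk_smul, smul_eq_mul, mul_one] at this

theorem isUnit_natCast_mul_level (hc : IsUnit (c (r - 1))) {n : ℕ} (hn : n ≠ 0) :
    IsUnit ((n : R) * (-2 * c (r - 1) ^ 2)) := by
  have h : (n : ℂ) * (-2) ≠ 0 := mul_ne_zero (Nat.cast_ne_zero.2 hn) (by norm_num)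
  have := (isUnit_of_complex (R := R) h).mul (hc.pow 2)
  rwa [map_mul, map_natCast, map_neg, map_ofNat, mul_assoc] at this

theorem shiftedMode_apply_natCast {n : ℕ} {i : ℤ} (hn : (r : ℤ) - 1 + i = n) (hi : 0 ≤ i)
    (v : IrregularVerma r κ Q c) :
    shiftedMode r κ Q c i v = modeEnd r κ Q c n v - baseEigenvalue r Q c n • v := by
  rw [shiftedMode, hn, extEigenvalue, if_pos (by omega), Int.toNat_natCast]
  rfl

/-- A vector with the same `L_n`-eigenvalues, `n ≥ r`, as the irregular vector is a multiple of
it. -/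
theorem exists_eq_smul_irregularVector (hr : 2 ≤ r) (hc : IsUnit (c (r - 1)))
    {v : IrregularVerma r κ Q c}
    (hv : ∀ n : ℕ, r ≤ n → modeEnd r κ Q c n v = baseEigenvalue r Q c n • v) :
    ∃ t : R, v = t • irregularVector r κ Q c := by
  obtain ⟨d, hd⟩ := exists_mem_wordFiltration hr v
  have := (isAlmostHeisenberg hr).mem_span_of_forall_eq_zero
    (fun n hn => isUnit_natCast_mul_level hc hn) d hd (fun i hi => by
      obtain ⟨n, hn⟩ := Int.eq_ofNat_of_zero_le (show 0 ≤ (r : ℤ) - 1 + i by omega)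
      rw [shiftedMode_apply_natCast hn (by omega), hv n (by omega), sub_self])
  obtain ⟨t, ht⟩ := Submodule.mem_span_singleton.1 this
  exact ⟨t, ht.symm⟩

/-- The recursion step for the coefficients of an eigenvector: `(L_n - Λ'_n) u = δ_{n,2r-1} v` for
`n ≥ r` has a solution `u`, provided that `v` satisfies equations of the same kind. -/
theorem exists_next_coeff (hr : 2 ≤ r) (hc : IsUnit (c (r - 1))) {v v' : IrregularVerma r κ Q c}
    (hv : ∀ n : ℕ, r ≤ n → modeEnd r κ Q c n v = baseEigenvalue r Q c n • v +
      if n = 2 * r - 1 then v' else 0) :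
    ∃ u : IrregularVerma r κ Q c, ∀ n : ℕ, r ≤ n →
      modeEnd r κ Q c n u = baseEigenvalue r Q c n • u + if n = 2 * r - 1 then v else 0 := by
  obtain ⟨d, hd⟩ := exists_mem_wordFiltration hr v
  have hv0 : ∀ i : ℤ, 1 ≤ i → i ≠ r → shiftedMode r κ Q c i v = 0 := by
    intro i hi hir
    obtain ⟨n, hn⟩ := Int.eq_ofNat_of_zero_le (show 0 ≤ (r : ℤ) - 1 + i by omega)
    rw [shiftedMode_apply_natCast hn (by omega), hv n (by omega), if_neg (by omega), add_zero,
      sub_self]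
  obtain ⟨u, -, hu⟩ := (isAlmostHeisenberg hr).exists_apply_eq
    (fun n hn => isUnit_natCast_mul_level hc hn) (d + r) (fun i => if i = r then v else 0)
    (fun i hi => by
      split_ifs with h
      · exact wordFiltration_mono (by push_cast; omega) hd
      · exact zero_mem _)
    (fun i j hi hj => by
      rw [if_neg (show ¬ (i + j + ((r : ℤ) - 1) = r) by omega), smul_zero, add_zero]
      by_cases h1 : i = r <;> by_cases h2 : j = r
      · rw [h1, h2]
      · rw [if_neg h2, if_pos h1, map_zero, hv0 j hj h2]
      · rw [if_pos h2, if_neg h1, map_zero, hv0 i hi h1]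
      · rw [if_neg h2, if_neg h1, map_zero, map_zero])
  refine ⟨u, fun n hn => ?_⟩
  have := hu (n - (r - 1)) (by omega)
  rw [shiftedMode_apply_natCast (n := n) (by omega) (by omega), sub_eq_iff_eq_add'] at this
  rw [this]
  congr 1
  by_cases h : n = 2 * r - 1
  · rw [if_pos h, if_pos (by omega)]
  · rw [if_neg h, if_neg (by omega)]

end Verma

/-! ### Formal power series with coefficients in a module -/

/-- Formal power series `∑_k Λ^k v_k` with coefficients `v_k` in `M`. -/
def ModuleSeries (M : Type*) : Type _ := ℕ → M

namespace ModuleSeries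

variable {R M : Type*}

@[ext]
theorem ext {u v : ModuleSeries M} (h : ∀ k, u k = v k) : u = v := funext h

variable [CommRing R] [AddCommGroup M] [Module R M]

instance : AddCommGroup (ModuleSeries M) := inferInstanceAs (AddCommGroup (ℕ → M))

theorem add_apply (u v : ModuleSeries M) (k : ℕ) : (u + v) k = u k + v k := rfl

theorem sub_apply (u v : ModuleSeries M) (k : ℕ) : (u - v) k = u k - v k := rfl

theorem zero_apply (k : ℕ) : (0 : ModuleSeries M) k = 0 := rfl

instance : SMul R⟦X⟧ (ModuleSeries M) :=
  ⟨fun f v k => ∑ p ∈ antidiagonal k, PowerSeries.coeff p.1 f • v p.2⟩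

theorem smul_apply (f : R⟦X⟧) (v : ModuleSeries M) (k : ℕ) :
    (f • v) k = ∑ p ∈ antidiagonal k, PowerSeries.coeff p.1 f • v p.2 := rfl

theorem monomial_smul_apply (a : R) (n : ℕ) (v : ModuleSeries M) (k : ℕ) :
    (PowerSeries.monomial n a • v) k = if n ≤ k then a • v (k - n) else 0 := by
  rw [smul_apply]
  split_ifs with h
  · rw [Finset.sum_eq_single (n, k - n)]
    · rw [PowerSeries.coeff_monomial_same]
    · rintro ⟨i, j⟩ hij hne
      rw [PowerSeries.coeff_monomial, if_neg, zero_smul]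
      rintro rfl
      rw [mem_antidiagonal] at hij
      exact hne (Prod.ext rfl (by simp only at hij ⊢; omega))
    · intro h'
      rw [mem_antidiagonal] at h'
      omega
  · refine Finset.sum_eq_zero fun p hp => ?_
    rw [mem_antidiagonal] at hp
    rw [PowerSeries.coeff_monomial, if_neg (by omega), zero_smul]

instance : Module R⟦X⟧ (ModuleSeries M) where
  one_smul v := by
    ext k
    have := monomial_smul_apply (1 : R) 0 v k
    rw [PowerSeries.monomial_zero_eq_C_apply, map_one] at this
    rw [this, if_pos (Nat.zero_le _), one_smul, Nat.sub_zero]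
  mul_smul f g v := by
    ext k
    simp only [smul_apply, PowerSeries.coeff_mul, Finset.sum_smul, Finset.smul_sum, mul_smul]
    rw [Finset.sum_sigma', Finset.sum_sigma']
    refine Finset.sum_nbij' (fun x => ⟨(x.2.1, x.2.2 + x.1.2), (x.2.2, x.1.2)⟩)
      (fun x => ⟨(x.1.1 + x.2.1, x.2.2), (x.1.1, x.2.1)⟩) ?_ ?_ ?_ ?_ ?_
    · simp only [Finset.mem_sigma, mem_antidiagonal]; grind
    · simp only [Finset.mem_sigma, mem_antidiagonal]; grind
    · rintro ⟨⟨a, b⟩, c, d⟩ h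
      simp only [Finset.mem_sigma, mem_antidiagonal] at h
      obtain ⟨h1, rfl⟩ := h
      rfl
    · rintro ⟨⟨a, b⟩, c, d⟩ h
      simp only [Finset.mem_sigma, mem_antidiagonal] at h
      obtain ⟨h1, rfl⟩ := h
      rfl
    · intros; rfl
  smul_zero f := by
    ext k
    simp only [smul_apply, zero_apply, smul_zero, Finset.sum_const_zero]
  smul_add f u v := by
    ext k
    simp only [smul_apply, add_apply, smul_add, Finset.sum_add_distrib]
  add_smul f g v := by
    ext k
    simp only [smul_apply, add_apply, map_add, add_smul, Finset.sum_add_distrib]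
  zero_smul v := by
    ext k
    simp only [smul_apply, zero_apply, map_zero, zero_smul, Finset.sum_const_zero]

theorem sum_apply {ι : Type*} (s : Finset ι) (u : ι → ModuleSeries M) (k : ℕ) :
    (∑ i ∈ s, u i) k = ∑ i ∈ s, u i k :=
  Finset.sum_apply k s u

theorem C_smul_apply (a : R) (v : ModuleSeries M) (k : ℕ) : (PowerSeries.C a • v) k = a • v k := by
  rw [← PowerSeries.monomial_zero_eq_C_apply, monomial_smul_apply, if_pos (Nat.zero_le _),
    Nat.sub_zero]

theorem X_pow_smul_apply (n : ℕ) (v : ModuleSeries M) (k : ℕ) :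
    ((PowerSeries.X ^ n : R⟦X⟧) • v) k = if n ≤ k then v (k - n) else 0 := by
  rw [PowerSeries.X_pow_eq, monomial_smul_apply]
  simp only [one_smul]

theorem X_smul_apply (v : ModuleSeries M) (k : ℕ) :
    ((PowerSeries.X : R⟦X⟧) • v) k = if 1 ≤ k then v (k - 1) else 0 := by
  rw [← X_pow_smul_apply (R := R) 1, pow_one]

theorem X_pow_smul_injective (n : ℕ) :
    Function.Injective fun v : ModuleSeries M => (PowerSeries.X ^ n : R⟦X⟧) • v := by
  intro u v h
  ext k
  have := congrFun h (k + n)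
  simpa only [X_pow_smul_apply, Nat.le_add_left, if_true, Nat.add_sub_cancel] using this

theorem X_smul_injective :
    Function.Injective fun v : ModuleSeries M => (PowerSeries.X : R⟦X⟧) • v := by
  simpa using X_pow_smul_injective (R := R) (M := M) 1

/-- Coefficientwise application of a linear operator. -/
def map (φ : Module.End R M) : Module.End R⟦X⟧ (ModuleSeries M) where
  toFun v k := φ (v k)
  map_add' u v := by
    ext k
    exact map_add φ _ _
  map_smul' f v := by
    ext k
    simp only [smul_apply, map_sum, map_smul, RingHom.id_apply]
    rfl

theorem map_apply (φ : Module.End R M) (v : ModuleSeries M) (k : ℕ) : map φ v k = φ (v k) := rfl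

variable (R M) in
/-- The Euler operator `Λ ∂/∂Λ`. -/
def euler : ModuleSeries M →+ ModuleSeries M where
  toFun v k := (k : R) • v k
  map_zero' := by
    ext k
    exact smul_zero _
  map_add' u v := by
    ext k
    exact smul_add _ _ _

theorem euler_apply (v : ModuleSeries M) (k : ℕ) : euler R M v k = (k : R) • v k := rfl

theorem euler_smul (f : R⟦X⟧) (v : ModuleSeries M) :
    euler R M (f • v) = (PowerSeries.X * PowerSeries.derivative R f) • v + f • euler R M v := by
  ext k
  simp only [add_apply, euler_apply, smul_apply, Finset.smul_sum, ← Finset.sum_add_distrib]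
  refine Finset.sum_congr rfl fun p hp => ?_
  rw [mem_antidiagonal] at hp
  have h : PowerSeries.coeff p.1 (PowerSeries.X * PowerSeries.derivative R f) =
      (p.1 : R) * PowerSeries.coeff p.1 f := by
    cases p.1 with
    | zero => simp
    | succ n =>
      rw [PowerSeries.coeff_succ_X_mul, PowerSeries.coeff_derivative]
      push_cast
      ring
  rw [h, ← hp]
  push_cast
  module

theorem euler_map (φ : Module.End R M) (v : ModuleSeries M) :
    euler R M (map φ v) = map φ (euler R M v) := by
  ext k
  simp only [euler_apply, map_apply, map_smul]

/-- A series with torsion-free leading coefficient is torsion-free. -/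
theorem eq_zero_of_smul_eq_zero {v : ModuleSeries M} (hv : ∀ t : R, t • v 0 = 0 → t = 0)
    {f : R⟦X⟧} (hf : f • v = 0) : f = 0 := by
  ext k
  rw [map_zero]
  induction k using Nat.strong_induction_on with
  | _ k ih =>
    refine hv _ ?_
    have := congrFun hf k
    rw [smul_apply, Finset.sum_eq_single (k, 0)] at this
    · exact this
    · rintro ⟨i, j⟩ hij hne
      rw [mem_antidiagonal] at hij
      rw [ih i, zero_smul]
      by_contra hik
      exact hne (Prod.ext (by simp only at hij ⊢; omega) (by simp only at hij ⊢; omega))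
    · intro h
      exact absurd (mem_antidiagonal.2 (add_zero k)) h

/-- Let `E` be a space of series that is closed under multiplication by power series and under
division by `Λ`. If the leading coefficients of the elements of `E` are multiples of the one of
`v ∈ E`, then all elements of `E` are multiples of `v`. -/
theorem exists_eq_smul (E : Submodule R⟦X⟧ (ModuleSeries M)) {v : ModuleSeries M} (hv : v ∈ E)
    (hX : ∀ u, (PowerSeries.X : R⟦X⟧) • u ∈ E → u ∈ E) (h0 : ∀ u ∈ E, ∃ t : R, u 0 = t • v 0)
    {u : ModuleSeries M} (hu : u ∈ E) : ∃ f : R⟦X⟧, u = f • v := by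
  choose! t ht using h0
  set next : ModuleSeries M → ModuleSeries M := fun u k => (u - PowerSeries.C (t u) • v) (k + 1)
    with hnext
  have hX_next : ∀ u ∈ E, u = PowerSeries.C (t u) • v + (PowerSeries.X : R⟦X⟧) • next u := by
    intro u hu
    ext k
    rw [add_apply, X_smul_apply]
    rcases k with _ | k
    · rw [if_neg (by omega), add_zero, C_smul_apply, ht u hu]
    · rw [if_pos (by omega), Nat.add_sub_cancel]
      simp only [hnext, sub_apply, add_sub_cancel]
  have hnextE : ∀ u ∈ E, next u ∈ E := by
    intro u hu
    refine hX _ ?_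
    rw [← sub_eq_iff_eq_add'.2 (hX_next u hu)]
    exact sub_mem hu (E.smul_mem _ hv)
  set q : ModuleSeries M → R⟦X⟧ := fun u => PowerSeries.mk fun n => t (next^[n] u) with hq
  have hq_next : ∀ u, q u = PowerSeries.C (t u) + PowerSeries.X * q (next u) := by
    intro u
    ext n
    rcases n with _ | n
    · simp [hq]
    · rw [map_add, PowerSeries.coeff_succ_X_mul, PowerSeries.coeff_C, if_neg (by omega), zero_add]
      simp only [hq, PowerSeries.coeff_mk, Function.iterate_succ_apply]
  refine ⟨q u, ?_⟩
  ext k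
  induction k generalizing u with
  | zero =>
    rw [hq_next, add_smul, mul_smul, add_apply, X_smul_apply, if_neg (by omega), add_zero,
      C_smul_apply, ht u hu]
  | succ k ih =>
    rw [hq_next, add_smul, mul_smul, add_apply, X_smul_apply, if_pos (by omega),
      Nat.add_sub_cancel, ← ih (hnextE u hu)]
    conv_lhs => rw [hX_next u hu]
    rw [add_apply, X_smul_apply, if_pos (by omega), Nat.add_sub_cancel]

end ModuleSeries

section LinearODE

variable {R : Type*} [CommRing R] [Algebra ℂ R]

/-- The coefficients of the solution of `f' = ψ f` with `f(0) = 1`. -/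
def linearODECoeff (ψ : R⟦X⟧) : ℕ → R
  | 0 => 1
  | n + 1 => algebraMap ℂ R ((n : ℂ) + 1)⁻¹ *
      ∑ i : Fin (n + 1), PowerSeries.coeff (n - i) ψ * linearODECoeff ψ i

theorem exists_derivative_eq_mul (ψ : R⟦X⟧) :
    ∃ f : R⟦X⟧, PowerSeries.coeff 0 f = 1 ∧ PowerSeries.derivative R f = ψ * f := by
  refine ⟨PowerSeries.mk (linearODECoeff ψ), ?_, ?_⟩
  · rw [PowerSeries.coeff_mk, linearODECoeff]
  · ext n
    rw [PowerSeries.coeff_derivative, PowerSeries.coeff_mk, linearODECoeff, mul_comm ψ,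
      PowerSeries.coeff_mul, Finset.Nat.sum_antidiagonal_eq_sum_range_succ_mk,
      ← Fin.sum_univ_eq_sum_range (fun i => PowerSeries.coeff i (PowerSeries.mk (linearODECoeff ψ)) *
        PowerSeries.coeff (n - i) ψ)]
    have h1 : algebraMap ℂ R ((n : ℂ) + 1)⁻¹ * ((n : R) + 1) = 1 := by
      have : ((n : R) + 1) = algebraMap ℂ R ((n : ℂ) + 1) := by simp
      rw [this, ← map_mul, inv_mul_cancel₀ (Nat.cast_add_one_ne_zero n), map_one]
    rw [mul_right_comm, h1, one_mul]
    refine Finset.sum_congr rfl fun i _ => ?_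
    rw [PowerSeries.coeff_mk, mul_comm]

theorem eq_one_of_derivative_eq_zero {f : R⟦X⟧} (h0 : PowerSeries.coeff 0 f = 1)
    (hf : PowerSeries.derivative R f = 0) : f = 1 := by
  ext n
  rcases n with _ | n
  · rw [h0]
    simp
  · have := congrArg (PowerSeries.coeff n) hf
    rw [PowerSeries.coeff_derivative, map_zero] at this
    have hu : IsUnit ((n : R) + 1) := by
      have := isUnit_of_complex (R := R) (Nat.cast_add_one_ne_zero n)
      rwa [map_add, map_natCast, map_one] at this
    rw [hu.mul_left_eq_zero.1 this, PowerSeries.coeff_one, if_neg (by omega)]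

end LinearODE

/-! ### The canonical operator -/

section FieldMatrix

variable {R : Type*} [CommRing R]

variable (R) in
/-- The Laurent polynomials `∑_{i ≥ j} p_i T^i`, as a module over the polynomials. -/
def orderGE (j : ℤ) : Submodule (Polynomial R) R[T;T⁻¹] :=
  Submodule.span (Polynomial R) {LaurentPolynomial.T j}

theorem mem_orderGE {j : ℤ} {x : R[T;T⁻¹]} :
    x ∈ orderGE R j ↔ ∃ p : Polynomial R, x = Polynomial.toLaurent p * LaurentPolynomial.T j := by
  rw [orderGE, Submodule.mem_span_singleton]
  refine exists_congr fun p => ?_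
  rw [Algebra.smul_def, LaurentPolynomial.algebraMap_eq_toLaurent, eq_comm]

theorem mul_mem_orderGE {i j k : ℤ} (h : k ≤ i + j) {x y : R[T;T⁻¹]} (hx : x ∈ orderGE R i)
    (hy : y ∈ orderGE R j) : x * y ∈ orderGE R k := by
  obtain ⟨p, rfl⟩ := mem_orderGE.1 hx
  obtain ⟨q, rfl⟩ := mem_orderGE.1 hy
  refine mem_orderGE.2 ⟨p * q * Polynomial.X ^ (i + j - k).toNat, ?_⟩
  have e : (LaurentPolynomial.T i * LaurentPolynomial.T j : R[T;T⁻¹]) =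
      LaurentPolynomial.T ((i + j - k).toNat : ℤ) * LaurentPolynomial.T k := by
    rw [← LaurentPolynomial.T_add, ← LaurentPolynomial.T_add]
    congr 1
    omega
  rw [map_mul, map_mul, Polynomial.toLaurent_X_pow]
  linear_combination (Polynomial.toLaurent p * Polynomial.toLaurent q) * e

theorem C_mul_T_mem_orderGE (a : R) {i k : ℤ} (h : k ≤ i) :
    LaurentPolynomial.C a * LaurentPolynomial.T i ∈ orderGE R k :=
  mem_orderGE.2 ⟨Polynomial.C a * Polynomial.X ^ (i - k).toNat, by
    rw [map_mul, Polynomial.toLaurent_C, Polynomial.toLaurent_X_pow, mul_assoc,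
      ← LaurentPolynomial.T_add, show ((i - k).toNat : ℤ) + k = i by omega]⟩

theorem C_mem_orderGE (a : R) : LaurentPolynomial.C a ∈ orderGE R 0 := by
  simpa using C_mul_T_mem_orderGE a (le_refl (0 : ℤ))

/-- `C u * T i` with a unit `u` can be cancelled. -/
theorem mem_orderGE_of_mul_mem {u : R} (hu : IsUnit u) {i j : ℤ} {x : R[T;T⁻¹]}
    (hx : x * (LaurentPolynomial.C u * LaurentPolynomial.T i) ∈ orderGE R (j + i)) :
    x ∈ orderGE R j := by
  obtain ⟨u, rfl⟩ := hu
  have h := mul_mem_orderGE (k := j) (by omega) hx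
    (C_mul_T_mem_orderGE (↑u⁻¹ : R) (le_refl (-i)))
  have e : (LaurentPolynomial.C (u : R) * LaurentPolynomial.T i) *
      (LaurentPolynomial.C (↑u⁻¹ : R) * LaurentPolynomial.T (-i)) = 1 := by
    rw [mul_mul_mul_comm, ← map_mul, Units.mul_inv, ← LaurentPolynomial.T_add, add_neg_cancel,
      map_one, LaurentPolynomial.T_zero, mul_one]
  rwa [mul_assoc, e, mul_one] at h

theorem natCast_mem_orderGE (n : ℕ) : (n : R[T;T⁻¹]) ∈ orderGE R 0 := by
  rw [← map_natCast (LaurentPolynomial.C : R →+* R[T;T⁻¹])]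
  exact C_mem_orderGE _

theorem eulerField_of_lt {r : ℕ} {c : ℕ → R} {k : Fin r} {a : ℕ} (h : (k : ℕ) + 1 = a)
    (ha : a < r) : eulerField r c k = (a : R[T;T⁻¹]) * LaurentPolynomial.C (c a) := by
  subst h
  rw [eulerField, if_neg (by omega), map_mul, ← Nat.cast_add_one, map_natCast]

variable [Algebra ℂ R]

theorem evalAt_mem_orderGE (r : ℕ) (c : ℕ → R) (f : MvPolynomial ℕ ℂ) :
    evalAt r c f ∈ orderGE R 0 := by
  induction f using MvPolynomial.induction_on with
  | C z =>
    rw [evalAt, MvPolynomial.aeval_C, IsScalarTower.algebraMap_apply ℂ R,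
      LaurentPolynomial.algebraMap_apply]
    exact C_mem_orderGE _
  | add f g hf hg => rw [map_add]; exact add_mem hf hg
  | mul_X f n hf =>
    rw [map_mul]
    refine mul_mem_orderGE (by omega) hf (j := 0) ?_
    rw [evalAt, MvPolynomial.aeval_X]
    split_ifs
    · simpa using C_mul_T_mem_orderGE (1 : R) (show (0 : ℤ) ≤ 1 by omega)
    · exact C_mem_orderGE _

theorem evalAt_coordC {r a : ℕ} (c : ℕ → R) (ha : 1 ≤ a) (har : a < r) :
    evalAt r c (coordC r a) = LaurentPolynomial.C (c a) := by
  rw [coordC, if_pos ⟨ha, har⟩, evalAt, MvPolynomial.aeval_X, if_neg (by omega)]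

theorem applyField_mul (r : ℕ) (c : ℕ → R) (h : Fin r → R[T;T⁻¹]) (f g : MvPolynomial ℕ ℂ) :
    applyField r c h (f * g) =
      evalAt r c f * applyField r c h g + evalAt r c g * applyField r c h f := by
  simp only [applyField, Derivation.leibniz, smul_eq_mul, map_add, map_mul, Finset.mul_sum,
    ← Finset.sum_add_distrib]
  exact Finset.sum_congr rfl fun k _ => by ring

theorem applyField_neg_sum (r : ℕ) (c : ℕ → R) (h : Fin r → R[T;T⁻¹]) (s : Finset ℕ)
    (f : ℕ → MvPolynomial ℕ ℂ) :
    applyField r c h (-∑ a ∈ s, f a) = -∑ a ∈ s, applyField r c h (f a) := by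
  simp only [applyField, map_neg, map_sum, mul_neg, Finset.sum_neg_distrib, Finset.mul_sum]
  rw [Finset.sum_comm]

theorem applyField_eulerField_coordC (r : ℕ) (c : ℕ → R) (a : ℕ) :
    applyField r c (eulerField r c) (coordC r a) = (a : R[T;T⁻¹]) * evalAt r c (coordC r a) := by
  simp only [applyField, pderiv_coordC]
  by_cases ha : 1 ≤ a ∧ a < r
  · rw [Finset.sum_eq_single ⟨a - 1, by omega⟩, evalAt_coordC c ha.1 ha.2]
    · have e : a - 1 + 1 = a := by omega
      rw [if_pos ⟨e.symm, show 1 ≤ a - 1 + 1 by omega, show a - 1 + 1 < r by omega⟩, map_one,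
        mul_one, eulerField_of_lt e ha.2]
    · intro k _ hk
      rw [if_neg, map_zero, mul_zero]
      rintro ⟨rfl, -⟩
      exact hk (Fin.ext (by simp))
    · simp
  · rw [coordC, if_neg ha, map_zero, mul_zero]
    refine Finset.sum_eq_zero fun k _ => ?_
    rw [if_neg (by omega), map_zero, mul_zero]

/-- `S_n` is homogeneous of degree `n`. -/
theorem applyField_eulerField (r : ℕ) (c : ℕ → R) {n : ℕ} (h1 : r ≤ n) (h2 : n ≤ 2 * r - 1) :
    applyField r c (eulerField r c) (S r n) = (n : R[T;T⁻¹]) * evalAt r c (S r n) := by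
  unfold S
  split_ifs with h3 h4
  · rw [applyField_neg_sum, map_neg, map_sum, mul_neg, Finset.mul_sum]
    congr 1
    refine Finset.sum_congr rfl fun a ha => ?_
    rw [Finset.mem_Icc] at ha
    rw [applyField_mul, applyField_eulerField_coordC, applyField_eulerField_coordC, map_mul]
    have : (n : R[T;T⁻¹]) = (a : R[T;T⁻¹]) + ((n - a : ℕ) : R[T;T⁻¹]) := by
      rw [← Nat.cast_add, show a + (n - a) = n by omega]
    rw [this]
    ring
  · rcases Nat.eq_zero_or_pos r with rfl | hr
    · simp [applyField, h4]
    rw [applyField, Finset.sum_eq_single ⟨r - 1, by omega⟩]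
    · simp only [show r - 1 + 1 = r by omega, eulerField, if_true]
      rw [MvPolynomial.pderiv_X_self, map_one, mul_one, evalAt, MvPolynomial.aeval_X, if_pos rfl,
        h4, Nat.cast_sub (by omega), map_sub, map_mul, map_ofNat, map_natCast, map_one]
      push_cast
      ring
    · intro k _ hk
      rw [MvPolynomial.pderiv_X_of_ne, map_zero, mul_zero]
      intro h
      exact hk (Fin.ext (show (k : ℕ) = r - 1 by omega))
    · simp
  · omega

variable {r : ℕ} {c : ℕ → R} (hc : IsUnit (c (r - 1)))

theorem applyField_fieldMatrix (m : Fin r) {n : ℕ} (h1 : r ≤ n) (h2 : n ≤ 2 * r - 1) :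
    applyField r c (fieldMatrix r c hc m) (S r n) =
      ((n : R[T;T⁻¹]) - (m : ℕ)) * evalAt r c (S r (n + m)) := by
  by_cases hm : (m : ℕ) = 0
  · have : fieldMatrix r c hc m = eulerField r c := by
      funext k
      simp [fieldMatrix, hm]
    rw [this, applyField_eulerField r c h1 h2, hm, Nat.cast_zero, sub_zero, add_zero]
  · have : fieldMatrix r c hc m = truncatedField r c hc m m.2 := by
      funext k
      simp [fieldMatrix, hm]
    rw [this, (truncatedField_spec r c hc m m.2).2 n h1 h2]

/-- The row of `T^r ℳ⁻¹` that belongs to `∂/∂Λ_{2r-1}`: the coefficients of `L_*`. -/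
def canonicalRow (hr : 2 ≤ r) (m : Fin r) : R[T;T⁻¹] :=
  LaurentPolynomial.T r * (fieldMatrix r c hc)⁻¹ ⟨r - 1, by omega⟩ m

theorem sum_canonicalRow_mul (hr : 2 ≤ r) (k : Fin r) :
    ∑ m, canonicalRow hc hr m * fieldMatrix r c hc m k =
      if (k : ℕ) = r - 1 then LaurentPolynomial.T r else 0 := by
  have h := congrFun (congrFun (Matrix.nonsing_inv_mul _ (isUnit_fieldMatrix_det r c hc))
    ⟨r - 1, by omega⟩) k
  rw [Matrix.mul_apply, Matrix.one_apply] at h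
  simp only [canonicalRow, mul_assoc]
  rw [← Finset.mul_sum, h]
  by_cases hk : (k : ℕ) = r - 1
  · rw [if_pos (Fin.ext hk.symm), if_pos hk, mul_one]
  · rw [if_neg fun h => hk (by rw [← h]), if_neg hk, mul_zero]

/-- `∑_m a_m 𝒱_m = Λ^r ∂/∂Λ`, evaluated on `S_n`. -/
theorem sum_canonicalRow_eigenvalue (hr : 2 ≤ r) {n : ℕ} (h1 : r ≤ n) (h2 : n ≤ 2 * r - 1) :
    ∑ m, canonicalRow hc hr m * (((n : R[T;T⁻¹]) - (m : ℕ)) * evalAt r c (S r (n + m))) =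
      if n = 2 * r - 1 then LaurentPolynomial.T r else 0 := by
  have e : ∀ m, canonicalRow hc hr m *
      (((n : R[T;T⁻¹]) - (m : ℕ)) * evalAt r c (S r (n + m))) =
      ∑ k : Fin r, (canonicalRow hc hr m * fieldMatrix r c hc m k) *
        evalAt r c (MvPolynomial.pderiv ((k : ℕ) + 1) (S r n)) := by
    intro m
    rw [← applyField_fieldMatrix hc m h1 h2, applyField, Finset.mul_sum]
    exact Finset.sum_congr rfl fun k _ => (mul_assoc _ _ _).symm
  rw [Finset.sum_congr rfl fun m _ => e m, Finset.sum_comm]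
  simp only [← Finset.sum_mul, sum_canonicalRow_mul]
  rw [Finset.sum_eq_single ⟨r - 1, by omega⟩]
  · simp only [if_true, show r - 1 + 1 = r by omega]
    unfold S
    split_ifs with h3 h4 h4
    · omega
    · rw [map_neg, map_sum, Finset.sum_eq_zero, neg_zero, map_zero, mul_zero]
      intro a _
      rw [Derivation.leibniz, pderiv_coordC, pderiv_coordC, if_neg (by omega), if_neg (by omega),
        smul_zero, smul_zero, add_zero]
    · rw [MvPolynomial.pderiv_X_self, map_one, mul_one]
    · omega
  · intro k _ hk
    rw [if_neg fun h => hk (Fin.ext h), zero_mul]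
  · simp

theorem fieldMatrix_eq_zero {m k : Fin r} (hm : (m : ℕ) ≠ 0) (hk : r < (k : ℕ) + 1 + m) :
    fieldMatrix r c hc m k = 0 := by
  rw [fieldMatrix, Matrix.of_apply, if_neg hm]
  exact (truncatedField_spec r c hc m m.2).1 k (by omega)

/-- The antidiagonal entries of `ℳ` are unit multiples of `Λ_{2r-1}`. -/
theorem fieldMatrix_rev (m : Fin r) : ∃ u : R, IsUnit u ∧
    fieldMatrix r c hc m m.rev = LaurentPolynomial.C u * LaurentPolynomial.T 1 := by
  have hm := m.2
  have hrev := Fin.val_rev m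
  by_cases h0 : (m : ℕ) = 0
  · refine ⟨2 * r - 1, ?_, ?_⟩
    · have hz : (2 * (r : ℂ) - 1) ≠ 0 := by
        have : ((2 * (r : ℤ) - 1 : ℤ) : ℂ) ≠ 0 := by
          rw [Int.cast_ne_zero]; omega
        push_cast at this
        exact this
      have hu := isUnit_of_complex (R := R) hz
      rwa [map_sub, map_mul, map_ofNat, map_natCast, map_one] at hu
    · rw [fieldMatrix, Matrix.of_apply, if_pos h0, eulerField, if_pos (by omega)]
  · have h2 : IsUnit (-2 * c (r - 1)) := by
      have := (isUnit_of_complex (R := R) (neg_ne_zero.2 (two_ne_zero' ℂ))).mul hc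
      rwa [map_neg, map_ofNat] at this
    obtain ⟨v, hv⟩ := h2
    have hz : (((r + (m.rev : Fin r) : ℕ) : ℂ) - ((m : ℕ) : ℂ)) ≠ 0 := by
      have : (((r + (m.rev : Fin r) : ℕ) : ℤ) - ((m : ℕ) : ℤ) : ℤ) ≠ 0 := by omega
      have := (Int.cast_ne_zero (α := ℂ)).2 this
      push_cast at this ⊢
      exact this
    have hu := isUnit_of_complex (R := R) hz
    rw [map_sub, map_natCast, map_natCast] at hu
    refine ⟨↑v⁻¹ * (((r + (m.rev : Fin r) : ℕ) : R) - ((m : ℕ) : R)), v⁻¹.isUnit.mul hu, ?_⟩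
    have e := applyField_fieldMatrix hc m (n := r + m.rev) (by omega) (by omega)
    have hsum : applyField r c (fieldMatrix r c hc m) (S r (r + m.rev)) =
        fieldMatrix r c hc m m.rev * LaurentPolynomial.C (v : R) := by
      have hdiag := jacobian_diag r c m.rev
      rw [if_neg (by omega), ← hv] at hdiag
      rw [applyField, Finset.sum_eq_single m.rev, ← hdiag]
      · rfl
      · intro k _ hk
        rcases lt_or_gt_of_ne hk with hlt | hgt
        · have : jacobian r c m.rev k = 0 := jacobian_blockTriangular r c hlt
          rw [jacobian, Matrix.of_apply] at this
          rw [this, mul_zero]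
        · have hgt : (m.rev : ℕ) < k := hgt
          rw [fieldMatrix_eq_zero hc h0 (by omega), zero_mul]
      · intro hk
        exact absurd (Finset.mem_univ _) hk
    have hS : evalAt r c (S r (r + m.rev + m)) = LaurentPolynomial.T 1 := by
      unfold S
      rw [if_neg (by omega), if_pos (by omega), evalAt, MvPolynomial.aeval_X, if_pos rfl]
    rw [hsum, hS] at e
    have hv1 : LaurentPolynomial.C (v : R) * LaurentPolynomial.C (↑v⁻¹ : R) = 1 := by
      rw [← map_mul, Units.mul_inv, map_one]
    calc fieldMatrix r c hc m m.rev = fieldMatrix r c hc m m.rev *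
        LaurentPolynomial.C (v : R) * LaurentPolynomial.C (↑v⁻¹ : R) := by
          rw [mul_assoc, hv1, mul_one]
      _ = _ := by
          rw [e, map_mul, map_sub, map_natCast, map_natCast]
          ring

theorem fieldMatrix_mem_orderGE (m k : Fin r) : fieldMatrix r c hc m k ∈ orderGE R 0 := by
  by_cases h0 : (m : ℕ) = 0
  · rw [fieldMatrix, Matrix.of_apply, if_pos h0, eulerField]
    split_ifs
    · exact C_mul_T_mem_orderGE _ (by omega)
    · exact C_mem_orderGE _
  · -- back substitution in the triangular system with the Jacobian matrix
    have hdown : ∀ (d : ℕ) (k : Fin r), r - 1 - k = d → fieldMatrix r c hc m k ∈ orderGE R 0 := by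
      intro d
      induction d using Nat.strong_induction_on with
      | _ d ih =>
        intro k hk
        have hk' := k.2
        have e := applyField_fieldMatrix hc m (n := r + k) (by omega) (by omega)
        rw [applyField, ← Finset.add_sum_erase _ _ (Finset.mem_univ k), ← eq_sub_iff_add_eq] at e
        have hdiag := jacobian_diag r c k
        rw [jacobian, Matrix.of_apply] at hdiag
        have hrhs : fieldMatrix r c hc m k *
            evalAt r c (MvPolynomial.pderiv ((k : ℕ) + 1) (S r (r + k))) ∈ orderGE R 0 := by
          rw [e]
          refine sub_mem (mul_mem_orderGE (i := 0) (j := 0) (by omega)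
            (sub_mem (natCast_mem_orderGE _) (natCast_mem_orderGE _)) (evalAt_mem_orderGE r c _))
            (sum_mem fun l hl => ?_)
          rcases lt_or_gt_of_ne (Finset.ne_of_mem_erase hl) with hlt | hgt
          · have : jacobian r c k l = 0 := jacobian_blockTriangular r c hlt
            rw [jacobian, Matrix.of_apply] at this
            rw [this, mul_zero]
            exact zero_mem _
          · have hgt : (k : ℕ) < l := hgt
            exact mul_mem_orderGE (i := 0) (j := 0) (by omega)
              (ih (r - 1 - l) (by have := l.2; omega) l rfl) (evalAt_mem_orderGE r c _)
        rw [hdiag] at hrhs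
        have h2 : IsUnit (-2 * c (r - 1)) := by
          have := (isUnit_of_complex (R := R) (neg_ne_zero.2 (two_ne_zero' ℂ))).mul hc
          rwa [map_neg, map_ofNat] at this
        split_ifs at hrhs
        · rwa [mul_one] at hrhs
        · refine mem_orderGE_of_mul_mem h2 (i := 0) ?_
          rwa [LaurentPolynomial.T_zero, mul_one, add_zero]
    exact hdown _ k rfl

/-- The coefficients of `L_*` are polynomials in `Λ_{2r-1}`; more precisely, the coefficient of
`L_m` is divisible by `Λ_{2r-1}^{r-1-m}`. -/
theorem canonicalRow_mem_orderGE (hr : 2 ≤ r) (m : Fin r) :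
    canonicalRow hc hr m ∈ orderGE R ((r : ℤ) - 1 - m) := by
  have key : ∀ (d : ℕ) (m : Fin r), (m : ℕ) = d →
      canonicalRow hc hr m ∈ orderGE R ((r : ℤ) - 1 - m) := by
    intro d
    induction d using Nat.strong_induction_on with
    | _ d ih =>
      intro m hm
      have hmr := m.2
      have hrev := Fin.val_rev m
      obtain ⟨u, hu, hmat⟩ := fieldMatrix_rev hc m
      have e := sum_canonicalRow_mul hc hr m.rev
      rw [← Finset.add_sum_erase _ _ (Finset.mem_univ m), ← eq_sub_iff_add_eq, hmat] at e
      refine mem_orderGE_of_mul_mem hu (i := 1) ?_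
      rw [e]
      refine sub_mem ?_ (sum_mem fun l hl => ?_)
      · split_ifs
        · simpa using C_mul_T_mem_orderGE (1 : R) (show (r : ℤ) - 1 - m + 1 ≤ r by omega)
        · exact zero_mem _
      · rcases lt_or_gt_of_ne (Finset.ne_of_mem_erase hl) with hlt | hgt
        · have hlt : (l : ℕ) < m := hlt
          exact mul_mem_orderGE (by omega) (ih l (by omega) l rfl) (fieldMatrix_mem_orderGE hc l _)
        · have hgt : (m : ℕ) < l := hgt
          rw [fieldMatrix_eq_zero hc (by omega) (by omega), mul_zero]
          exact zero_mem _
  exact key m m rfl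

/-- The coefficient of `L_1` in `L_*` is a unit multiple of `Λ_{2r-1}^{r-2}`. -/
theorem canonicalRow_one (hr : 2 ≤ r) : ∃ u : R, IsUnit u ∧
    canonicalRow hc hr ⟨1, by omega⟩ =
      LaurentPolynomial.C u * LaurentPolynomial.T ((r - 2 : ℕ) : ℤ) := by
  set m0 : Fin r := ⟨0, by omega⟩ with hm0
  set m1 : Fin r := ⟨1, by omega⟩ with hm1
  obtain ⟨u0, ⟨u0, rfl⟩, hmat0⟩ := fieldMatrix_rev hc m0
  obtain ⟨u1, ⟨u1, rfl⟩, hmat1⟩ := fieldMatrix_rev hc m1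
  have hrev0 : (m0.rev : ℕ) = r - (0 + 1) := Fin.val_rev m0
  have hrev1 : (m1.rev : ℕ) = r - (1 + 1) := Fin.val_rev m1
  have e0 := sum_canonicalRow_mul hc hr m0.rev
  rw [Finset.sum_eq_single m0, if_pos (by omega), hmat0] at e0
  rotate_left
  · intro l _ hl
    have : (l : ℕ) ≠ 0 := fun h => hl (Fin.ext h)
    rw [fieldMatrix_eq_zero hc this (by omega), mul_zero]
  · simp
  have e1 := sum_canonicalRow_mul hc hr m1.rev
  rw [← Finset.add_sum_erase _ _ (Finset.mem_univ m0), Finset.sum_eq_single m1,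
    if_neg (by omega), hmat1] at e1
  rotate_left
  · intro l hl hl'
    have h0 : (l : ℕ) ≠ 0 := fun h => Finset.ne_of_mem_erase hl (Fin.ext h)
    have h1 : (l : ℕ) ≠ 1 := fun h => hl' (Fin.ext h)
    rw [fieldMatrix_eq_zero hc (by omega) (by omega), mul_zero]
  · intro h
    refine absurd (Finset.mem_erase.2 ⟨?_, Finset.mem_univ _⟩) h
    rw [hm0, hm1, Ne, Fin.mk.injEq]
    omega
  have hw : fieldMatrix r c hc m0 m1.rev =
      LaurentPolynomial.C (((r - 1 : ℕ) : R) * c (r - 1)) := by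
    rw [fieldMatrix, Matrix.of_apply, if_pos rfl, eulerField, if_neg (by omega),
      show (m1.rev : ℕ) + 1 = r - 1 by omega, ← Nat.cast_add_one,
      show (m1.rev : ℕ) + 1 = r - 1 by omega]
  have hwu : IsUnit (((r - 1 : ℕ) : R) * c (r - 1)) := by
    have hz : ((r - 1 : ℕ) : ℂ) ≠ 0 := Nat.cast_ne_zero.2 (by omega)
    have := (isUnit_of_complex (R := R) hz).mul hc
    rwa [map_natCast] at this
  rw [hw] at e1
  have hCT : ∀ (u : Rˣ) (i : ℤ), (LaurentPolynomial.C (u : R) * LaurentPolynomial.T i) *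
      (LaurentPolynomial.C (↑u⁻¹ : R) * LaurentPolynomial.T (-i)) = 1 := by
    intro u i
    rw [mul_mul_mul_comm, ← map_mul, Units.mul_inv, ← LaurentPolynomial.T_add, add_neg_cancel,
      map_one, LaurentPolynomial.T_zero, mul_one]
  have f0 : canonicalRow hc hr m0 = LaurentPolynomial.T (r : ℤ) *
      (LaurentPolynomial.C (↑u0⁻¹ : R) * LaurentPolynomial.T (-1)) := by
    rw [← e0, mul_assoc, hCT, mul_one]
  have f1 : canonicalRow hc hr m1 = -(canonicalRow hc hr m0 *
      LaurentPolynomial.C (((r - 1 : ℕ) : R) * c (r - 1))) *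
      (LaurentPolynomial.C (↑u1⁻¹ : R) * LaurentPolynomial.T (-1)) := by
    rw [← eq_neg_iff_add_eq_zero.2 ((add_comm _ _).trans e1), mul_assoc, hCT, mul_one]
  refine ⟨-(↑u0⁻¹ * (((r - 1 : ℕ) : R) * c (r - 1)) * ↑u1⁻¹),
    ((u0⁻¹.isUnit.mul hwu).mul u1⁻¹.isUnit).neg, ?_⟩
  have hT : (LaurentPolynomial.T ((r - 2 : ℕ) : ℤ) : R[T;T⁻¹]) = LaurentPolynomial.T (r : ℤ) *
      LaurentPolynomial.T (-1) * LaurentPolynomial.T (-1) := by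
    rw [← LaurentPolynomial.T_add, ← LaurentPolynomial.T_add]
    congr 1
    omega
  rw [f1, f0, hT]
  simp only [map_neg, map_mul]
  ring

variable (r c) in
/-- The eigenvalue `Λ_n` of `L_n`, `n ≥ r`, on the irregular vector of half-integer rank, as a
polynomial in `Λ_{2r-1}`. -/
def eigenvalue (Q : R) (n : ℕ) : Polynomial R :=
  Polynomial.C (baseEigenvalue r Q c n) + if n = 2 * r - 1 then Polynomial.X else 0

theorem evalAt_S (hr : 2 ≤ r) (Q : R) {n : ℕ} (hn : r ≤ n) :
    evalAt r c (S r n) = Polynomial.toLaurent (eigenvalue r c Q n) := by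
  unfold S eigenvalue
  split_ifs with h1 h2 h2
  · omega
  · rw [add_zero, Polynomial.toLaurent_C, baseEigenvalue, if_neg (by omega), zero_sub, map_neg,
      map_neg, map_sum, map_sum]
    congr 1
    refine Finset.sum_congr rfl fun a ha => ?_
    rw [Finset.mem_Icc] at ha
    rw [map_mul, evalAt_coordC c ha.1 (by omega)]
    by_cases hna : n - a < r
    · rw [evalAt_coordC c (by omega) hna, ← map_mul, Finset.sum_eq_single (n - a),
        if_pos (by omega)]
      · intro q _ hq
        exact if_neg (by omega)
      · rw [Finset.mem_Icc]
        omega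
    · rw [coordC, if_neg (by omega), map_zero, mul_zero, eq_comm, Finset.sum_eq_zero, map_zero]
      intro q hq
      rw [Finset.mem_Icc] at hq
      exact if_neg (by omega)
  · rw [baseEigenvalue_eq_zero hr (by omega), map_zero, zero_add, Polynomial.toLaurent_X, evalAt,
      MvPolynomial.aeval_X, if_pos rfl]
  · rw [baseEigenvalue_eq_zero hr (by omega), map_zero, map_zero, add_zero, map_zero]

/-- The properties of the coefficients of `L_*` as polynomials in `Λ_{2r-1}`. -/
theorem exists_canonicalPolynomial (hr : 2 ≤ r) (Q : R) : ∃ A : Fin r → Polynomial R,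
    (∀ m, canonicalRow hc hr m = Polynomial.toLaurent (A m)) ∧
    (∀ n : ℕ, r ≤ n → ∑ m, A m * (((n : Polynomial R) - (m : ℕ)) * eigenvalue r c Q (n + m)) =
      if n = 2 * r - 1 then Polynomial.X ^ r else 0) ∧
    ∃ u : R, IsUnit u ∧ A ⟨1, by omega⟩ = Polynomial.C u * Polynomial.X ^ (r - 2) := by
  have h : ∀ m, ∃ p : Polynomial R, canonicalRow hc hr m = Polynomial.toLaurent p := by
    intro m
    obtain ⟨p, hp⟩ := mem_orderGE.1 (canonicalRow_mem_orderGE hc hr m)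
    refine ⟨p * Polynomial.X ^ (r - 1 - (m : ℕ)), ?_⟩
    rw [hp, map_mul, Polynomial.toLaurent_X_pow]
    congr 2
    omega
  choose A hA using h
  refine ⟨A, hA, fun n hn => ?_, ?_⟩
  · rcases le_or_gt n (2 * r - 1) with h2 | h2
    · apply Polynomial.toLaurent_injective
      have := sum_canonicalRow_eigenvalue hc hr hn h2
      rw [apply_ite Polynomial.toLaurent, map_zero, Polynomial.toLaurent_X_pow, ← this, map_sum]
      refine Finset.sum_congr rfl fun m _ => ?_
      rw [map_mul, map_mul, ← hA, ← evalAt_S hr Q (by omega), map_sub, map_natCast, map_natCast]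
    · rw [if_neg (by omega)]
      refine Finset.sum_eq_zero fun m _ => ?_
      rw [eigenvalue, baseEigenvalue_eq_zero hr (by omega), if_neg (by omega), map_zero, add_zero,
        mul_zero, mul_zero]
  · obtain ⟨u, hu, h1⟩ := canonicalRow_one hc hr
    refine ⟨u, hu, Polynomial.toLaurent_injective ?_⟩
    rw [← hA, h1, map_mul, Polynomial.toLaurent_C, Polynomial.toLaurent_X_pow]

end FieldMatrix

/-! ### Eigenvectors of the canonical system -/

section Eigen

theorem X_pow_mul_X {R : Type*} [CommRing R] {r : ℕ} (hr : 2 ≤ r) :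
    (PowerSeries.X ^ r : R⟦X⟧) = PowerSeries.X ^ (r - 1) * PowerSeries.X := by
  rw [← pow_succ, show r - 1 + 1 = r by omega]

theorem eigenvalue_eq_zero {R : Type*} [CommRing R] {r : ℕ} {Q : R} {c : ℕ → R} (hr : 2 ≤ r)
    {n : ℕ} (hn : 2 * r ≤ n) : eigenvalue r c Q n = 0 := by
  rw [eigenvalue, baseEigenvalue_eq_zero hr (by omega), if_neg (by omega), map_zero, add_zero]

variable {R : Type*} [CommRing R] [Algebra ℂ R] {r : ℕ} {κ Q : R} {c : ℕ → R}

variable (r κ Q c) in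
/-- The coefficientwise action of `L_n` on power series in `Λ_{2r-1}`. -/
def modeSeries (n : ℤ) : Module.End R⟦X⟧ (ModuleSeries (IrregularVerma r κ Q c)) :=
  ModuleSeries.map (modeEnd r κ Q c n)

theorem modeSeries_comm {m n : ℕ} (h : m + n ≠ 0)
    (v : ModuleSeries (IrregularVerma r κ Q c)) :
    modeSeries r κ Q c m (modeSeries r κ Q c n v) = modeSeries r κ Q c n (modeSeries r κ Q c m v) +
      ((m : R⟦X⟧) - (n : R⟦X⟧)) • modeSeries r κ Q c ((m + n : ℕ) : ℤ) v := by
  ext k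
  have e : (m : R⟦X⟧) - (n : R⟦X⟧) = PowerSeries.C ((m : R) - (n : R)) := by
    rw [map_sub, map_natCast, map_natCast]
  simp only [modeSeries, ModuleSeries.add_apply, ModuleSeries.map_apply, e,
    ModuleSeries.C_smul_apply]
  rw [modeEnd_comm, if_neg (by omega), zero_smul, add_zero]
  push_cast
  rfl

variable (r κ Q c) in
/-- The series `v` with `L_n v = Λ_n v` for all `n ≥ r`. -/
def eigenSeries : Submodule R⟦X⟧ (ModuleSeries (IrregularVerma r κ Q c)) where
  carrier := {v | ∀ n : ℕ, r ≤ n →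
    modeSeries r κ Q c n v = (eigenvalue r c Q n : R⟦X⟧) • v}
  add_mem' hu hv n hn := by rw [map_add, hu n hn, hv n hn, smul_add]
  zero_mem' n _ := by rw [map_zero, smul_zero]
  smul_mem' f v hv n hn := by rw [map_smul, hv n hn, smul_comm]

theorem mem_eigenSeries {v : ModuleSeries (IrregularVerma r κ Q c)} :
    v ∈ eigenSeries r κ Q c ↔ ∀ n : ℕ, r ≤ n →
      modeSeries r κ Q c n v = (eigenvalue r c Q n : R⟦X⟧) • v := Iff.rfl

theorem eigenvalue_smul_apply (n : ℕ) (v : ModuleSeries (IrregularVerma r κ Q c)) (k : ℕ) :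
    ((eigenvalue r c Q n : R⟦X⟧) • v) k = baseEigenvalue r Q c n • v k +
      if n = 2 * r - 1 then (if 1 ≤ k then v (k - 1) else 0) else 0 := by
  rw [eigenvalue, Polynomial.coe_add, add_smul, ModuleSeries.add_apply, Polynomial.coe_C,
    ModuleSeries.C_smul_apply]
  congr 1
  split_ifs with h1 h2
  · rw [Polynomial.coe_X, ModuleSeries.X_smul_apply, if_pos h2]
  · rw [Polynomial.coe_X, ModuleSeries.X_smul_apply, if_neg ‹_›]
  · rw [Polynomial.coe_zero, zero_smul, ModuleSeries.zero_apply]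

/-- The system `L_n v = Λ_n v`, `n ≥ r`, has a solution starting with the irregular vector. -/
theorem exists_mem_eigenSeries (hr : 2 ≤ r) (hc : IsUnit (c (r - 1))) :
    ∃ v ∈ eigenSeries r κ Q c, v 0 = irregularVector r κ Q c := by
  -- `Good p` says that `p.2` may follow `p.1` in the sequence of coefficients.
  set Good : IrregularVerma r κ Q c × IrregularVerma r κ Q c → Prop := fun p =>
    ∀ n : ℕ, r ≤ n → modeEnd r κ Q c n p.2 = baseEigenvalue r Q c n • p.2 +
      if n = 2 * r - 1 then p.1 else 0 with hGood
  have hstep : ∀ p : {p // Good p}, ∃ u, Good (p.1.2, u) :=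
    fun p => exists_next_coeff hr hc p.2
  choose next hnext using hstep
  have hinit : Good (0, irregularVector r κ Q c) := by
    intro n hn
    rw [mode_smul_irregularVector (by omega), ite_self, add_zero]
  set seq : ℕ → {p // Good p} := fun k =>
    Nat.rec ⟨_, hinit⟩ (fun _ p => ⟨(p.1.2, next p), hnext p⟩) k with hseq
  set w : ModuleSeries (IrregularVerma r κ Q c) := fun k => (seq k).1.2 with hw
  refine ⟨w, mem_eigenSeries.2 fun n hn => ?_, rfl⟩
  ext k
  rw [eigenvalue_smul_apply]
  refine ((seq k).2 n hn).trans ?_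
  rcases k with _ | k
  · rfl
  · rw [if_pos (by omega : 1 ≤ k + 1)]
    rfl

/-- Any two eigenvectors differ by a scalar power series. -/
theorem exists_eq_smul_of_mem_eigenSeries (hr : 2 ≤ r) (hc : IsUnit (c (r - 1)))
    {u v : ModuleSeries (IrregularVerma r κ Q c)} (hv : v ∈ eigenSeries r κ Q c)
    (hv0 : v 0 = irregularVector r κ Q c) (hu : u ∈ eigenSeries r κ Q c) :
    ∃ f : R⟦X⟧, u = f • v := by
  refine ModuleSeries.exists_eq_smul _ hv (fun u hu => ?_) (fun u hu => ?_) hu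
  · refine mem_eigenSeries.2 fun n hn => ModuleSeries.X_smul_injective (R := R) ?_
    have := mem_eigenSeries.1 hu n hn
    rwa [map_smul, smul_comm] at this
  · rw [hv0]
    refine exists_eq_smul_irregularVector hr hc fun n hn => ?_
    have := congrFun (mem_eigenSeries.1 hu n hn) 0
    rw [eigenvalue_smul_apply, if_neg (by omega : ¬ 1 ≤ 0), ite_self, add_zero] at this
    exact this

/-- The operator `∑_m A_m L_m - Λ^r ∂/∂Λ` on power series. -/
def canonicalOp (A : Fin r → Polynomial R) (v : ModuleSeries (IrregularVerma r κ Q c)) :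
    ModuleSeries (IrregularVerma r κ Q c) :=
  ∑ m, (A m : R⟦X⟧) • modeSeries r κ Q c (m : ℕ) v -
    (PowerSeries.X ^ (r - 1) : R⟦X⟧) • ModuleSeries.euler R _ v

theorem canonicalOp_smul (hr : 2 ≤ r) (A : Fin r → Polynomial R) (f : R⟦X⟧)
    (v : ModuleSeries (IrregularVerma r κ Q c)) :
    canonicalOp A (f • v) =
      f • canonicalOp A v - (PowerSeries.X ^ r * PowerSeries.derivative R f) • v := by
  rw [canonicalOp, canonicalOp, ModuleSeries.euler_smul, smul_sub, Finset.smul_sum,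
    X_pow_mul_X hr]
  simp only [map_smul, smul_comm f]
  rw [smul_add, smul_smul _ (PowerSeries.X * _), ← mul_assoc]
  abel

/-- The commutator of `L_n - Λ_n` with `∑_m A_m L_m - Λ^r ∂/∂Λ`. Since `∑_m A_m 𝒱_m = Λ^r ∂/∂Λ`,
it is a combination of the `L_{n+m} - Λ_{n+m}`. -/
theorem modeSeries_canonicalOp (hr : 2 ≤ r) {A : Fin r → Polynomial R}
    (hA : ∀ n : ℕ, r ≤ n →
      ∑ m, A m * (((n : Polynomial R) - (m : ℕ)) * eigenvalue r c Q (n + m)) =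
        if n = 2 * r - 1 then Polynomial.X ^ r else 0)
    {n : ℕ} (hn : r ≤ n) {v : ModuleSeries (IrregularVerma r κ Q c)}
    (hv : modeSeries r κ Q c n v = (eigenvalue r c Q n : R⟦X⟧) • v) :
    modeSeries r κ Q c n (canonicalOp A v) = (eigenvalue r c Q n : R⟦X⟧) • canonicalOp A v +
      ∑ m : Fin r, ((A m : R⟦X⟧) * ((n : R⟦X⟧) - (m : ℕ))) •
        (modeSeries r κ Q c ((n + m : ℕ) : ℤ) v - (eigenvalue r c Q (n + m) : R⟦X⟧) • v) := by
  have h1 : ∀ m : Fin r, modeSeries r κ Q c n ((A m : R⟦X⟧) • modeSeries r κ Q c (m : ℕ) v) =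
      (eigenvalue r c Q n : R⟦X⟧) • (A m : R⟦X⟧) • modeSeries r κ Q c (m : ℕ) v +
        ((A m : R⟦X⟧) * ((n : R⟦X⟧) - (m : ℕ))) • modeSeries r κ Q c ((n + m : ℕ) : ℤ) v := by
    intro m
    rw [map_smul, modeSeries_comm (by omega), hv, map_smul, smul_add, smul_comm, mul_smul]
  have h2 : modeSeries r κ Q c n ((PowerSeries.X ^ (r - 1) : R⟦X⟧) • ModuleSeries.euler R _ v) =
      (eigenvalue r c Q n : R⟦X⟧) • (PowerSeries.X ^ (r - 1) : R⟦X⟧) • ModuleSeries.euler R _ v +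
        (PowerSeries.X ^ r * PowerSeries.derivative R (eigenvalue r c Q n : R⟦X⟧)) • v := by
    rw [map_smul, modeSeries, ← ModuleSeries.euler_map, ← modeSeries, hv, ModuleSeries.euler_smul,
      X_pow_mul_X hr, smul_add, smul_smul _ (PowerSeries.X * _), ← mul_assoc, smul_comm, add_comm]
  have h3 : PowerSeries.X ^ r * PowerSeries.derivative R (eigenvalue r c Q n : R⟦X⟧) =
      ∑ m : Fin r, ((A m : R⟦X⟧) * ((n : R⟦X⟧) - (m : ℕ))) * (eigenvalue r c Q (n + m) : R⟦X⟧) := by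
    have h := congrArg (Polynomial.coeToPowerSeries.ringHom (R := R)) (hA n hn)
    simp only [map_sum, map_mul, map_sub, map_natCast, Polynomial.coeToPowerSeries.ringHom_apply]
      at h
    simp only [mul_assoc]
    rw [h, PowerSeries.derivative_coe, eigenvalue]
    split_ifs <;> simp
  rw [canonicalOp, map_sub, map_sum, Finset.sum_congr rfl fun m _ => h1 m,
    Finset.sum_add_distrib, h2, h3, smul_sub, Finset.smul_sum, Finset.sum_smul]
  simp only [smul_sub, smul_smul, Finset.sum_sub_distrib]
  abel

theorem canonicalOp_mem_eigenSeries (hr : 2 ≤ r) {A : Fin r → Polynomial R}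
    (hA : ∀ n : ℕ, r ≤ n →
      ∑ m, A m * (((n : Polynomial R) - (m : ℕ)) * eigenvalue r c Q (n + m)) =
        if n = 2 * r - 1 then Polynomial.X ^ r else 0)
    {v : ModuleSeries (IrregularVerma r κ Q c)} (hv : v ∈ eigenSeries r κ Q c) :
    canonicalOp A v ∈ eigenSeries r κ Q c := by
  refine mem_eigenSeries.2 fun n hn => ?_
  rw [modeSeries_canonicalOp hr hA hn (hv n hn), Finset.sum_eq_zero, add_zero]
  intro m _
  rw [hv (n + m) (by omega), sub_self, smul_zero]

theorem eq_zero_of_isUnit_smul {u : R} (hu : IsUnit u)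
    {v : ModuleSeries (IrregularVerma r κ Q c)} (h : PowerSeries.C u • v = 0) : v = 0 := by
  obtain ⟨u, rfl⟩ := hu
  have := congrArg (PowerSeries.C (↑u⁻¹ : R) • ·) h
  simpa only [smul_smul, ← map_mul, Units.inv_mul, map_one, one_smul, smul_zero] using this

/-- If `v` is an eigenvector of `L_m` and `L_n`, then `[L_m, L_n] v = 0`. -/
theorem modeSeries_add_eq_zero {m n : ℕ} (hmn : n < m) {v : ModuleSeries (IrregularVerma r κ Q c)}
    {f g : R⟦X⟧} (hm : modeSeries r κ Q c m v = f • v) (hn : modeSeries r κ Q c n v = g • v) :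
    modeSeries r κ Q c ((m + n : ℕ) : ℤ) v = 0 := by
  have h := modeSeries_comm (by omega : m + n ≠ 0) v
  rw [hm, hn, map_smul, map_smul, hm, hn, smul_comm, left_eq_add] at h
  have hz : ((m : ℂ) - n) ≠ 0 := sub_ne_zero.2 (Nat.cast_injective.ne hmn.ne')
  have hu := isUnit_of_complex (R := R) hz
  rw [map_sub, map_natCast, map_natCast] at hu
  refine eq_zero_of_isUnit_smul hu ?_
  rwa [map_sub, map_natCast, map_natCast]

/-- The equations for `r ≤ n ≤ 2r - 1`, together with the canonical equation, imply the equations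
for all `n ≥ r`. All `L_n` with `n > 2r` are iterated commutators, but `L_{2r}` is not; it occurs,
with the coefficient `A_1`, in the commutator of `L_{2r-1}` with the canonical operator. -/
theorem mem_eigenSeries_of_canonical (hr : 2 ≤ r) {A : Fin r → Polynomial R}
    (hA : ∀ n : ℕ, r ≤ n →
      ∑ m, A m * (((n : Polynomial R) - (m : ℕ)) * eigenvalue r c Q (n + m)) =
        if n = 2 * r - 1 then Polynomial.X ^ r else 0)
    (hA1 : ∃ u : R, IsUnit u ∧ A ⟨1, by omega⟩ = Polynomial.C u * Polynomial.X ^ (r - 2))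
    {v : ModuleSeries (IrregularVerma r κ Q c)} {P : R⟦X⟧} (hD : canonicalOp A v = P • v)
    (hv : ∀ n : ℕ, r ≤ n → n ≤ 2 * r - 1 →
      modeSeries r κ Q c n v = (eigenvalue r c Q n : R⟦X⟧) • v) :
    v ∈ eigenSeries r κ Q c := by
  have hmid : ∀ n : ℕ, 2 * r + 1 ≤ n → n ≤ 3 * r - 1 → modeSeries r κ Q c n v = 0 := by
    intro n h1 h2
    have := modeSeries_add_eq_zero (by omega : r < n - r) (hv (n - r) (by omega) (by omega))
      (hv r le_rfl (by omega))
    rwa [show n - r + r = n by omega] at this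
  have h2r : modeSeries r κ Q c ((2 * r : ℕ) : ℤ) v = 0 := by
    have h := modeSeries_canonicalOp hr hA (n := 2 * r - 1) (by omega)
      (hv (2 * r - 1) (by omega) le_rfl)
    rw [hD, map_smul, hv (2 * r - 1) (by omega) le_rfl, smul_comm, left_eq_add,
      Finset.sum_eq_single ⟨1, by omega⟩] at h
    · obtain ⟨u, hu, hA1⟩ := hA1
      simp only at h
      rw [show 2 * r - 1 + 1 = 2 * r by omega, eigenvalue_eq_zero hr le_rfl, Polynomial.coe_zero,
        zero_smul, sub_zero, hA1, Polynomial.coe_mul, Polynomial.coe_C, Polynomial.coe_pow,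
        Polynomial.coe_X] at h
      have hz : (((2 * r - 1 : ℕ) : ℂ) - (1 : ℕ)) ≠ 0 :=
        sub_ne_zero.2 (Nat.cast_injective.ne (by omega))
      have hu' := isUnit_of_complex (R := R) hz
      rw [map_sub, map_natCast, map_natCast] at hu'
      refine ModuleSeries.X_pow_smul_injective (R := R) (r - 2) ?_
      simp only [smul_zero]
      refine eq_zero_of_isUnit_smul (hu.mul hu') ?_
      rw [← h, smul_smul, map_mul, map_sub, map_natCast, map_natCast]
      congr 1
      ring
    · intro m _ hm
      have hm1 : (m : ℕ) ≠ 1 := fun h => hm (Fin.ext h)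
      by_cases hm0 : (m : ℕ) = 0
      · rw [hm0, add_zero, hv (2 * r - 1) (by omega) le_rfl, sub_self, smul_zero]
      · rw [hmid _ (by omega) (by omega), eigenvalue_eq_zero hr (by omega), Polynomial.coe_zero,
          zero_smul, sub_zero, smul_zero]
    · simp
  refine mem_eigenSeries.2 fun n => ?_
  induction n using Nat.strong_induction_on with
  | _ n ih =>
    intro hn
    rcases le_or_gt n (2 * r - 1) with h1 | h1
    · exact hv n hn h1
    · rw [eigenvalue_eq_zero hr (by omega), Polynomial.coe_zero, zero_smul]
      by_cases h2 : n = 2 * r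
      · rw [h2, h2r]
      · have := modeSeries_add_eq_zero (by omega : r < n - r) (ih (n - r) (by omega) (by omega))
          (hv r le_rfl (by omega))
        rwa [show n - r + r = n by omega] at this

end Eigen

/-! ### The exponential prefactor -/

section Prefactor

variable {R : Type*} [CommRing R]

/-- The polynomial `Λ^r (ν / Λ - ∑_j j g_j / Λ^{j+1})`: `Λ^r` times the logarithmic derivative of
the prefactor `Λ^ν exp(∑_j g_j / Λ^j)`. The index `j` of `g` is shifted by one, to start from `0`. -/
def prefactor (r : ℕ) (ν : R) (g : Fin (r - 1) → R) : R⟦X⟧ :=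
  PowerSeries.monomial (r - 1) ν -
    ∑ j : Fin (r - 1), PowerSeries.monomial (r - 2 - (j : ℕ)) ((((j : ℕ) : R) + 1) * g j)

theorem coeff_prefactor_top {r : ℕ} (ν : R) (g : Fin (r - 1) → R) :
    PowerSeries.coeff (r - 1) (prefactor r ν g) = ν := by
  rw [prefactor, map_sub, PowerSeries.coeff_monomial_same, map_sum, Finset.sum_eq_zero, sub_zero]
  intro j _
  rw [PowerSeries.coeff_monomial, if_neg (by omega)]

theorem coeff_prefactor {r : ℕ} (ν : R) (g : Fin (r - 1) → R) (j : Fin (r - 1)) :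
    PowerSeries.coeff (r - 2 - (j : ℕ)) (prefactor r ν g) = -((((j : ℕ) : R) + 1) * g j) := by
  rw [prefactor, map_sub, PowerSeries.coeff_monomial, if_neg (by omega), map_sum,
    Finset.sum_eq_single j, PowerSeries.coeff_monomial_same, zero_sub]
  · intro i _ hi
    have : (i : ℕ) ≠ j := fun h => hi (Fin.ext h)
    rw [PowerSeries.coeff_monomial, if_neg (by omega)]
  · simp

variable [Algebra ℂ R]

theorem isUnit_natCast_add_one (j : ℕ) : IsUnit ((j : R) + 1) := by
  have := isUnit_of_complex (R := R) (Nat.cast_add_one_ne_zero j)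
  rwa [map_add, map_natCast, map_one] at this

/-- Every power series is congruent modulo `Λ^r` to some `prefactor r ν g`. -/
theorem exists_prefactor {r : ℕ} (hr : 2 ≤ r) (φ : R⟦X⟧) :
    ∃ (ν : R) (g : Fin (r - 1) → R) (ψ : R⟦X⟧), φ = prefactor r ν g + PowerSeries.X ^ r * ψ := by
  choose u hu using fun j : ℕ => isUnit_natCast_add_one (R := R) j
  have h : (PowerSeries.X : R⟦X⟧) ^ r ∣ φ - prefactor r (PowerSeries.coeff (r - 1) φ)
      fun j => -(↑(u j)⁻¹ * PowerSeries.coeff (r - 2 - (j : ℕ)) φ) := by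
    rw [PowerSeries.X_pow_dvd_iff]
    intro m hm
    rw [map_sub]
    by_cases h : m = r - 1
    · rw [h, coeff_prefactor_top, sub_self]
    · have e := coeff_prefactor (r := r) (PowerSeries.coeff (r - 1) φ)
        (fun j => -(↑(u j)⁻¹ * PowerSeries.coeff (r - 2 - (j : ℕ)) φ)) ⟨r - 2 - m, by omega⟩
      simp only [show r - 2 - (r - 2 - m) = m by omega] at e
      rw [e, ← hu, mul_neg, neg_neg, Units.mul_inv_cancel_left, sub_self]
  obtain ⟨ψ, hψ⟩ := h
  exact ⟨_, _, ψ, by rw [← hψ, add_sub_cancel]⟩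

theorem prefactor_injective {r : ℕ} {ν ν' : R} {g g' : Fin (r - 1) → R} (hr : 2 ≤ r)
    (h : (PowerSeries.X : R⟦X⟧) ^ r ∣ prefactor r ν' g' - prefactor r ν g) : ν' = ν ∧ g' = g := by
  rw [PowerSeries.X_pow_dvd_iff] at h
  constructor
  · have := h (r - 1) (by omega)
    rwa [map_sub, coeff_prefactor_top, coeff_prefactor_top, sub_eq_zero] at this
  · funext j
    have := h (r - 2 - (j : ℕ)) (by omega)
    rw [map_sub, coeff_prefactor, coeff_prefactor, sub_eq_zero, neg_inj] at this
    exact (isUnit_natCast_add_one (R := R) j).mul_left_cancel this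

end Prefactor

/-! ### Comparison with formal series indexed by the integers -/

section Comparison

variable {R M : Type*} [CommRing R] [AddCommGroup M] [Module R M] {d : ℕ}

/-- The extension of a sequence by zero to negative indices. -/
def extendByZero (v : ModuleSeries M) (k : ℤ) : M := if 0 ≤ k then v k.toNat else 0

theorem extendByZero_natCast (v : ModuleSeries M) (k : ℕ) : extendByZero v k = v k := by
  rw [extendByZero, if_pos (by omega), Int.toNat_natCast]

theorem extendByZero_of_neg (v : ModuleSeries M) {k : ℤ} (hk : k < 0) : extendByZero v k = 0 := by
  rw [extendByZero, if_neg (by omega)]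

theorem extendByZero_injective : Function.Injective (extendByZero : ModuleSeries M → ℤ → M) := by
  intro u v h
  ext k
  have := congrFun h (k : ℤ)
  rwa [extendByZero_natCast, extendByZero_natCast] at this

theorem extendByZero_add (u v : ModuleSeries M) (k : ℤ) :
    extendByZero (u + v) k = extendByZero u k + extendByZero v k := by
  unfold extendByZero
  split_ifs
  · rfl
  · rw [add_zero]

theorem extendByZero_sum {ι : Type*} (s : Finset ι) (u : ι → ModuleSeries M) (k : ℤ) :
    extendByZero (∑ i ∈ s, u i) k = ∑ i ∈ s, extendByZero (u i) k := by
  unfold extendByZero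
  split_ifs
  · exact ModuleSeries.sum_apply ..
  · rw [Finset.sum_const_zero]

theorem extendByZero_sub (u v : ModuleSeries M) (k : ℤ) :
    extendByZero (u - v) k = extendByZero u k - extendByZero v k := by
  unfold extendByZero
  split_ifs
  · rfl
  · rw [sub_zero]

theorem extendByZero_monomial_smul (a : R) (n : ℕ) (v : ModuleSeries M) (k : ℤ) :
    extendByZero (PowerSeries.monomial n a • v) k = a • extendByZero v (k - n) := by
  rcases lt_or_ge k 0 with hk | hk
  · rw [extendByZero_of_neg _ hk, extendByZero_of_neg _ (by omega), smul_zero]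
  · obtain ⟨k, rfl⟩ := Int.eq_ofNat_of_zero_le hk
    rw [extendByZero_natCast, ModuleSeries.monomial_smul_apply]
    split_ifs with h
    · rw [show ((k : ℤ) - n) = ((k - n : ℕ) : ℤ) by omega, extendByZero_natCast]
    · rw [extendByZero_of_neg _ (by omega), smul_zero]

theorem mulLaurent_coeff (p : R[T;T⁻¹]) (W : FormalSeries d R M) (k : ℤ) :
    (W.mulLaurent p).coeff k = p.coeff.sum fun i a => a • W.coeff (k - i) := rfl

theorem mulLaurent_add_coeff (p q : R[T;T⁻¹]) (W : FormalSeries d R M) (k : ℤ) :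
    (W.mulLaurent (p + q)).coeff k = (W.mulLaurent p).coeff k + (W.mulLaurent q).coeff k := by
  simp only [mulLaurent_coeff]
  exact Finsupp.sum_add_index' (fun _ => zero_smul _ _) fun _ _ _ => add_smul _ _ _

theorem mulLaurent_C_mul_T_coeff (a : R) (n : ℤ) (W : FormalSeries d R M) (k : ℤ) :
    (W.mulLaurent (LaurentPolynomial.C a * LaurentPolynomial.T n)).coeff k =
      a • W.coeff (k - n) := by
  rw [mulLaurent_coeff, ← LaurentPolynomial.single_eq_C_mul_T]
  exact Finsupp.sum_single_index (zero_smul _ _)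

theorem mulLaurent_toLaurent_coeff (p : Polynomial R) {W : FormalSeries d R M}
    {v : ModuleSeries M} (hW : W.coeff = extendByZero v) (k : ℤ) :
    (W.mulLaurent (Polynomial.toLaurent p)).coeff k = extendByZero ((p : R⟦X⟧) • v) k := by
  induction p using Polynomial.induction_on' with
  | add p q hp hq =>
    rw [map_add, mulLaurent_add_coeff, hp, hq, Polynomial.coe_add, add_smul, extendByZero_add]
  | monomial n a =>
    rw [Polynomial.toLaurent_C_mul_T, mulLaurent_C_mul_T_coeff, hW, Polynomial.coe_monomial,
      extendByZero_monomial_smul]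

theorem deriv_mulLaurent_coeff {r : ℕ} (hr : 2 ≤ r) {W : FormalSeries (r - 1) R M}
    {v : ModuleSeries M} (hW : W.coeff = extendByZero v) (k : ℤ) :
    (W.deriv.mulLaurent (LaurentPolynomial.T (r : ℤ))).coeff k =
      extendByZero ((PowerSeries.X ^ (r - 1) : R⟦X⟧) • ModuleSeries.euler R M v +
        prefactor r W.exponent W.polar • v) k := by
  have hT : (LaurentPolynomial.T (r : ℤ) : R[T;T⁻¹]) =
      LaurentPolynomial.C 1 * LaurentPolynomial.T (r : ℤ) := by rw [map_one, one_mul]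
  have he : ∀ n : ℤ, extendByZero (ModuleSeries.euler R M v) n = (n : R) • extendByZero v n := by
    intro n
    rcases lt_or_ge n 0 with hn | hn
    · rw [extendByZero_of_neg _ hn, extendByZero_of_neg _ hn, smul_zero]
    · obtain ⟨n, rfl⟩ := Int.eq_ofNat_of_zero_le hn
      rw [extendByZero_natCast, extendByZero_natCast, ModuleSeries.euler_apply, Int.cast_natCast]
  rw [hT, mulLaurent_C_mul_T_coeff, one_smul, prefactor, sub_smul, Finset.sum_smul,
    PowerSeries.X_pow_eq, extendByZero_add, extendByZero_sub, extendByZero_sum]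
  simp only [extendByZero_monomial_smul, he, one_smul, FormalSeries.deriv, hW]
  have e1 : k - r + 1 = k - ((r - 1 : ℕ) : ℤ) := by omega
  rw [e1, add_sub_assoc]
  congr 1
  · rw [← Int.cast_one, ← Int.cast_add, e1]
  · congr 1
    refine Finset.sum_congr rfl fun j _ => ?_
    rw [mul_smul]
    congr 3
    omega

end Comparison

section Main

variable {R : Type*} [CommRing R] [Algebra ℂ R] {r : ℕ} {κ Q : R} {c : ℕ → R}

theorem modeAct_coeff {n : ℤ} {W : FormalSeries (r - 1) R (IrregularVerma r κ Q c)}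
    {v : ModuleSeries (IrregularVerma r κ Q c)} (hW : W.coeff = extendByZero v) :
    (modeAct n W).coeff = extendByZero (modeSeries r κ Q c n v) := by
  funext k
  change mode R n • W.coeff k = _
  rw [hW]
  rcases lt_or_ge k 0 with hk | hk
  · rw [extendByZero_of_neg _ hk, extendByZero_of_neg _ hk, smul_zero]
  · obtain ⟨k, rfl⟩ := Int.eq_ofNat_of_zero_le hk
    rw [extendByZero_natCast, extendByZero_natCast]
    rfl

theorem modeAct_eq_iff (hr : 2 ≤ r) {n : ℕ} (hn : r ≤ n)
    {W : FormalSeries (r - 1) R (IrregularVerma r κ Q c)}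
    {v : ModuleSeries (IrregularVerma r κ Q c)} (hW : W.coeff = extendByZero v) :
    modeAct (n : ℤ) W = W.mulLaurent (evalAt r c (S r n)) ↔
      modeSeries r κ Q c n v = (eigenvalue r c Q n : R⟦X⟧) • v := by
  have h : (W.mulLaurent (evalAt r c (S r n))).coeff =
      extendByZero ((eigenvalue r c Q n : R⟦X⟧) • v) := by
    funext k
    rw [evalAt_S hr Q hn, mulLaurent_toLaurent_coeff _ hW]
  constructor
  · intro h'
    exact extendByZero_injective (by rw [← modeAct_coeff hW, h', h])
  · intro h'
    refine FormalSeries.ext rfl rfl ?_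
    rw [modeAct_coeff hW, h, h']

theorem lStar_eq_iff (hr : 2 ≤ r) (hc : IsUnit (c (r - 1))) {A : Fin r → Polynomial R}
    (hA : ∀ m, canonicalRow hc hr m = Polynomial.toLaurent (A m))
    {W : FormalSeries (r - 1) R (IrregularVerma r κ Q c)}
    {v : ModuleSeries (IrregularVerma r κ Q c)} (hW : W.coeff = extendByZero v) :
    lStar hr hc W = W.deriv.mulLaurent (LaurentPolynomial.T (r : ℤ)) ↔
      canonicalOp A v = prefactor r W.exponent W.polar • v := by
  have h1 : (lStar hr hc W).coeff =
      extendByZero (∑ m, (A m : R⟦X⟧) • modeSeries r κ Q c (m : ℕ) v) := by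
    funext k
    rw [extendByZero_sum]
    change ∑ m : Fin r, ((modeAct (m : ℕ) W).mulLaurent (canonicalRow hc hr m)).coeff k = _
    refine Finset.sum_congr rfl fun m _ => ?_
    rw [← mulLaurent_toLaurent_coeff _ (modeAct_coeff hW), ← hA]
  have h2 : (W.deriv.mulLaurent (LaurentPolynomial.T (r : ℤ))).coeff =
      extendByZero ((PowerSeries.X ^ (r - 1) : R⟦X⟧) • ModuleSeries.euler R _ v +
        prefactor r W.exponent W.polar • v) :=
    funext fun k => deriv_mulLaurent_coeff hr hW k
  rw [canonicalOp, sub_eq_iff_eq_add']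
  constructor
  · intro h
    exact extendByZero_injective (by rw [← h1, h, h2])
  · intro h
    refine FormalSeries.ext rfl rfl ?_
    rw [h1, h2, h]

theorem coeff_zero_smul_apply (f : R⟦X⟧) (v : ModuleSeries (IrregularVerma r κ Q c)) :
    (f • v) 0 = PowerSeries.coeff 0 f • v 0 := by
  rw [ModuleSeries.smul_apply]
  exact Finset.sum_singleton _ _

end Main

end IrregularVector

end

theorem mainTheorem2 {R : Type*} [CommRing R] [Algebra ℂ R] (r : ℕ) (hr : 2 ≤ r)
    (κ Q : R) (c : ℕ → R) (hc : IsUnit (c (r - 1))) :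
    ∃! W : IrregularVector.FormalSeries (r - 1) R (IrregularVector.IrregularVerma r κ Q c),
      (∀ k : ℤ, k < 0 → W.coeff k = 0) ∧
      W.coeff 0 = IrregularVector.irregularVector r κ Q c ∧
      IrregularVector.lStar hr hc W =
        W.deriv.mulLaurent (LaurentPolynomial.T (r : ℤ)) ∧
      ∀ n : ℕ, r ≤ n → n ≤ 2 * r - 1 →
        IrregularVector.modeAct (n : ℤ) W =
          W.mulLaurent (IrregularVector.evalAt r c (IrregularVector.S r n)) := by
  open IrregularVector in
  obtain ⟨A, hA, hAeig, hA1⟩ := exists_canonicalPolynomial hc hr Q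
  obtain ⟨v, hv, hv0⟩ := exists_mem_eigenSeries (κ := κ) (Q := Q) hr hc
  -- `canonicalOp A v` is an eigenvector again, hence `φ v`; modulo `Λ^r`, the series `φ` is the
  -- logarithmic derivative of the prefactor, and the rest is absorbed by a scalar series `f`.
  obtain ⟨φ, hφ⟩ := exists_eq_smul_of_mem_eigenSeries hr hc hv hv0
    (canonicalOp_mem_eigenSeries hr hAeig hv)
  obtain ⟨ν, g, ψ, rfl⟩ := exists_prefactor hr φ
  obtain ⟨f, hf0, hf⟩ := exists_derivative_eq_mul ψ
  set w := f • v with hw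
  have hwE : w ∈ eigenSeries r κ Q c := Submodule.smul_mem _ f hv
  have hw0 : w 0 = irregularVector r κ Q c := by
    rw [hw, coeff_zero_smul_apply, hf0, one_smul, hv0]
  have hwD : canonicalOp A w = prefactor r ν g • w := by
    rw [hw, canonicalOp_smul hr, hφ, hf, smul_smul, smul_smul, ← sub_smul]
    congr 1
    ring
  clear_value w
  refine ⟨⟨ν, g, extendByZero w⟩, ⟨fun k hk => extendByZero_of_neg w hk, ?_,
    (lStar_eq_iff hr hc hA rfl).2 hwD, fun n h1 h2 => (modeAct_eq_iff hr h1 rfl).2 (hwE n h1)⟩, ?_⟩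
  · exact (extendByZero_natCast w 0).trans hw0
  · rintro W ⟨hneg, hW0, hWD, hWE⟩
    set u : ModuleSeries (IrregularVerma r κ Q c) := fun k : ℕ => W.coeff k with hu
    have hWu : W.coeff = extendByZero u := by
      funext k
      rcases lt_or_ge k 0 with hk | hk
      · rw [hneg k hk, extendByZero_of_neg _ hk]
      · obtain ⟨k, rfl⟩ := Int.eq_ofNat_of_zero_le hk
        rw [extendByZero_natCast]
    have huD := (lStar_eq_iff hr hc hA hWu).1 hWD
    have huE := mem_eigenSeries_of_canonical hr hAeig hA1 huD
      fun n h1 h2 => (modeAct_eq_iff hr h1 hWu).1 (hWE n h1 h2)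
    obtain ⟨q, hq⟩ := exists_eq_smul_of_mem_eigenSeries hr hc hwE hw0 huE
    have htf : ∀ t : R, t • w 0 = 0 → t = 0 := by
      rw [hw0]
      exact eq_zero_of_smul_irregularVector hr
    have hq0 : PowerSeries.coeff 0 q = 1 := by
      rw [← sub_eq_zero]
      refine htf _ ?_
      have h : u 0 = irregularVector r κ Q c := hW0
      rw [sub_smul, one_smul, ← coeff_zero_smul_apply, ← hq, h, hw0, sub_self]
    have hrel : (prefactor r W.exponent W.polar - prefactor r ν g) * q +
        PowerSeries.X ^ r * PowerSeries.derivative R q = 0 := by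
      refine ModuleSeries.eq_zero_of_smul_eq_zero htf ?_
      have h := huD
      rw [hq, canonicalOp_smul hr, hwD, ← sub_eq_zero, smul_smul, smul_smul, ← sub_smul,
        ← sub_smul] at h
      rw [← neg_eq_zero, ← neg_smul, ← h]
      congr 1
      ring
    have hqu : IsUnit q := by
      rw [PowerSeries.isUnit_iff_constantCoeff,
        ← PowerSeries.coeff_zero_eq_constantCoeff_apply, hq0]
      exact isUnit_one
    obtain ⟨hν, hg⟩ := prefactor_injective (ν' := W.exponent) (g' := W.polar) (ν := ν) (g := g) hr
      ((hqu.dvd_mul_right).1 ⟨-PowerSeries.derivative R q, by linear_combination hrel⟩)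
    rw [hν, hg, sub_self, zero_mul, zero_add] at hrel
    have hq1 : q = 1 := by
      refine eq_one_of_derivative_eq_zero hq0 ?_
      ext n
      have := congrArg (PowerSeries.coeff (n + r)) hrel
      rwa [PowerSeries.coeff_X_pow_mul, map_zero] at this
    refine FormalSeries.ext hν hg ?_
    rw [hWu, hq, hq1, one_smul]
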